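/- Write permutations $\pi\in S_n$ in one-line notation $(\pi_1,\dots,\pi_n)$. Let $\mathrm{inv}(\pi)$ be the number of inversions of $\pi$, and let $\mathrm{sh}(\pi)$ be the shape of the insertion tableau of $\pi$ under the Robinson–Schensted correspondence. For a partition $\lambda$ of $n$, a permutation is *minimal* for $\lambda$ if it has the least number of inversions among all permutations of shape $\lambda$. Let $W_\lambda^\Delta$ be the set of permutations of shape $\lambda$ with exactly $\Delta$ more inversions than a minimal one. Let $t_i$ be the transposition $(i\;\,i+1)$; multiplication by $t_i$ on the right exchanges the entries at positions $i,i+1$, and multiplication by $t_i$ on the left exchanges the values $i,i+1$. For $c_1,c_2\ge 1$ with $c_1+c_2=n$, let $$\pi_{(c_1,c_2)}=(c_1,\dots,2,1\mid n,n-1,\dots,c_1+1).$$ A *jump partition* $J=(\mu,\nu)$ for $\pi_{(c_1,c_2)}$ is a pair of (possibly empty) partitions with at most $c_1$ parts and with all parts less than $c_2$. Its size is $|J|=|\mu|+|\nu|$. For a partition $\mu$ with $\ell$ parts put $$T_\mu=(t_{c_1}t_{c_1+1}\cdots t_{c_1-1+\mu_1})(t_{c_1-1}\cdots t_{c_1-2+\mu_2})\cdots(t_{c_1-\ell+1}\cdots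 t_{c_1-\ell+\mu_\ell}).$$ The result of applying $J$ to $\pi=\pi_{(c_1,c_2)}$ is $J(\pi)=T_\nu^{-1}\,\pi\,T_\mu$. **Theorem.** Let $s\ge r>\Delta\ge 0$ be integers, let $n=s+r$, and let $\lambda\vdash n$ be the partition with conjugate $\lambda'=(s,r)$. Then the minimal permutations for $\lambda$ are exactly $\pi_{(s,r)}$ and $\pi_{(r,s)}$ (which coincide if $s=r$). Moreover, for every minimal permutation $\pi$ for $\lambda$ and every jump partition $J$ of size $\Delta$ for $\pi$, the permutation $J(\pi)$ lies in $W_\lambda^\Delta$; that is, $J(\pi)$ has shape $\lambda$ and exactly $\Delta$ more inversions than a minimal permutation. -/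

import Mathlib

/-! Permutations of `{1, …, n}` are elements of `Equiv.Perm (Fin n)`; positions and values are
shifted down by one. Partitions are Young diagrams: for `μ : YoungDiagram`, the number
`μ.rowLen j` is the part `μ_{j+1}`, `μ.colLen 0` is the number of parts `ℓ(μ)`, `μ.card` is the
size `|μ|`, and `μ.transpose` is the conjugate partition. -/

namespace JumpPerm

section RobinsonSchensted

variable {α : Type*} [LinearOrder α]

/-- Insertion of `x` into an increasing row: the leftmost entry larger than `x`, which is the
smallest such entry, is replaced by `x` and returned as the bumped entry; if there is none, `x` is
added at the end. -/
def rowInsert (x : α) : List α → List α × Option α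
  | [] => ([x], none)
  | y :: ys =>
    if x < y then (x :: ys, some y)
    else (y :: (rowInsert x ys).1, (rowInsert x ys).2)

/-- Row insertion of `x` into a tableau, given as the list of its rows from top to bottom:
the entry bumped from a row is inserted into the next row. -/
def tableauInsert (x : α) : List (List α) → List (List α)
  | [] => [[x]]
  | row :: rows =>
    match (rowInsert x row).2 with
    | none => (rowInsert x row).1 :: rows
    | some y => (rowInsert x row).1 :: tableauInsert y rows

/-- The insertion tableau `P` of a word: its letters are inserted from left to right. -/
def insertionTableau (w : List α) : List (List α) :=
  w.foldl (fun T x => tableauInsert x T) []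

end RobinsonSchensted

/-- `sh(π) = lam`: the row lengths of the insertion tableau of the one-line notation
`(π 0, π 1, …)` are the parts of `lam`. -/
def HasShape {n : ℕ} (π : Equiv.Perm (Fin n)) (lam : YoungDiagram) : Prop :=
  (insertionTableau (List.ofFn fun i => π i)).map List.length = lam.rowLens

/-- The number of inversions of `π`. -/
def inv {n : ℕ} (π : Equiv.Perm (Fin n)) : ℕ :=
  (Finset.univ.filter fun p : Fin n × Fin n => p.1 < p.2 ∧ π p.2 < π p.1).card

/-- `π` is minimal for `lam`: it has shape `lam`, and no permutation of shape `lam` has fewer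
inversions. -/
def IsMinimal {n : ℕ} (lam : YoungDiagram) (π : Equiv.Perm (Fin n)) : Prop :=
  HasShape π lam ∧ ∀ σ : Equiv.Perm (Fin n), HasShape σ lam → inv π ≤ inv σ

/-- The set `W_lam^Δ` of the permutations of shape `lam` with exactly `Δ` more inversions than
the minimal ones. -/
def W (n : ℕ) (lam : YoungDiagram) (Δ : ℕ) : Set (Equiv.Perm (Fin n)) :=
  {σ | HasShape σ lam ∧ ∃ π : Equiv.Perm (Fin n), IsMinimal lam π ∧ inv σ = inv π + Δ}

/-- `π` is the layered permutation of the composition `(c₁, c₂)` of `n`, that is, in one-line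
notation with values `1, …, n`, `π = (c₁, …, 2, 1 | n, n - 1, …, c₁ + 1)`. -/
def IsLayered {n : ℕ} (c₁ c₂ : ℕ) (π : Equiv.Perm (Fin n)) : Prop :=
  0 < c₁ ∧ 0 < c₂ ∧ c₁ + c₂ = n ∧
    (∀ i : Fin n, (i : ℕ) < c₁ → (π i : ℕ) + 1 = c₁ - i) ∧
    (∀ i : Fin n, c₁ ≤ (i : ℕ) → (π i : ℕ) + 1 = n - (i - c₁))

/-- The adjacent transposition of the `i`-th and the `(i+1)`-st element of `Fin n`, counted
from 1, for `1 ≤ i ≤ n - 1`. (For other `i`, which do not occur below, it is the identity.) -/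
def adjSwap (n i : ℕ) : Equiv.Perm (Fin n) :=
  if h : 1 ≤ i ∧ i < n then Equiv.swap ⟨i - 1, by omega⟩ ⟨i, h.2⟩ else 1

/-- The product of adjacent transpositions
`(t_{c₁} ⋯ t_{c₁-1+μ₁}) (t_{c₁-1} ⋯ t_{c₁-2+μ₂}) ⋯ (t_{c₁-ℓ+1} ⋯ t_{c₁-ℓ+μ_ℓ})`, `ℓ = ℓ(μ)`. -/
def jumpProd (n c₁ : ℕ) (μ : YoungDiagram) : Equiv.Perm (Fin n) :=
  ((List.range (μ.colLen 0)).map fun j =>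
    ((List.range (μ.rowLen j)).map fun m => adjSwap n (c₁ - j + m)).prod).prod

/-- A jump partition for the minimal permutation that corresponds to the composition
`(c₁, c₂)`: a pair of an inner and an outer jump partition. -/
structure JumpPartition (c₁ c₂ : ℕ) where
  inner : YoungDiagram
  outer : YoungDiagram
  inner_length : inner.colLen 0 ≤ c₁
  inner_first : inner.rowLen 0 < c₂
  outer_length : outer.colLen 0 ≤ c₁
  outer_first : outer.rowLen 0 < c₂

/-- The size `|J| = |μ| + |ν|` of `J = (μ, ν)`. -/
def JumpPartition.size {c₁ c₂ : ℕ} (J : JumpPartition c₁ c₂) : ℕ :=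
  J.inner.card + J.outer.card

/-- `J(π) = ν ∘ π ∘ μ` for `J = (μ, ν)`. The inner jump partition acts by right multiplication by
its product of transpositions; the outer one acts by left multiplication by its product of
transpositions in the reverse order, i.e. by the inverse,
`(t_{c₁-ℓ+ν_ℓ} ⋯ t_{c₁-ℓ+1}) ⋯ (t_{c₁-1+ν₁} ⋯ t_{c₁})`. -/
def JumpPartition.apply {c₁ c₂ n : ℕ} (J : JumpPartition c₁ c₂) (π : Equiv.Perm (Fin n)) :
    Equiv.Perm (Fin n) :=
  (jumpProd n c₁ J.outer)⁻¹ * π * jumpProd n c₁ J.inner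

end JumpPerm

/-! Minimality and shape both become statements about noninversions, i.e. pairs in increasing order.
With two columns, Schensted's theorem determines the shape completely: no increasing triple, and
longest decreasing subsequence of length `s` (`hasShape_iff`). It is proved from scratch: each bump
is a series of Knuth moves, these preserve the lengths of monotone subwords, and in the reading word
of a tableau such lengths are the first row and the number of rows.

Minimal permutations: let `A` be a longest decreasing subsequence, so `|A| = s` and `|Aᶜ| = r`. The
positions forming a noninversion with a fixed `b` are themselves decreasing, since an increasing
pair among them would give an increasing triple with `b`; so there are at most `s` of them. Every
noninversion has an end outside `A`, hence there are at most `r * s`. Equality forces each `b ∉ A`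
to be in increasing order with exactly `A`, and then one block lies entirely to the left of and
below the other (`nonInv_le`, `isLayered_of_nonInvNeighbors`).

Jumps: the inverse of `jumpProd` keeps the order inside each of the two blocks, and its inversions
between the blocks are the cells of the diagram. Thus in `J.apply π` a cross pair is affected by a
cell of the inner diagram and by a cell of the outer diagram, rotated by 180° in the `c₁ × c₂`
rectangle. A small `J` makes these two cell sets disjoint, so exactly `J.size` noninversions are
lost (`JumpPartition.nonInv_apply`).

The shape survives: both blocks stay decreasing, so there is no increasing triple. A decreasing
sequence with `p, q > 0` elements in the blocks consumes `p * q` lost noninversions, so `p * q < r`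
and `p + q ≤ p * q + 1 ≤ r ≤ s` (`card_le_of_decreasing`). -/

namespace JumpPerm

/-! ### Monotone subwords and Knuth relations -/

section Chains

variable {α : Type*}

/-- Every `r`-chain that is a subword of `w` can be replaced by an equally long `r`-chain in `w'`
that has all the lower and upper `r`-bounds of the given one. -/
def ChainLe (r : α → α → Prop) (w w' : List α) : Prop :=
  ∀ l : List α, l.Sublist w → l.Pairwise r → ∃ l' : List α, l'.Sublist w' ∧ l'.Pairwise r ∧ l'.length = l.length ∧
    (∀ a, (∀ b ∈ l, r a b) → ∀ b ∈ l', r a b) ∧ (∀ a, (∀ b ∈ l, r b a) → ∀ b ∈ l', r b a)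

theorem ChainLe.refl (r : α → α → Prop) (w : List α) : ChainLe r w w :=
  fun l h₁ h₂ => ⟨l, h₁, h₂, rfl, fun _ h => h, fun _ h => h⟩

theorem ChainLe.trans {r : α → α → Prop} {w₁ w₂ w₃ : List α} (h : ChainLe r w₁ w₂)
    (h' : ChainLe r w₂ w₃) : ChainLe r w₁ w₃ := by
  intro l h₁ h₂
  obtain ⟨l', a₁, a₂, a₃, a₄, a₅⟩ := h l h₁ h₂
  obtain ⟨l'', b₁, b₂, b₃, b₄, b₅⟩ := h' l' a₁ a₂
  exact ⟨l'', b₁, b₂, b₃.trans a₃, fun a k => b₄ a (a₄ a k), fun a k => b₅ a (a₅ a k)⟩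

theorem ChainLe.append {r : α → α → Prop} {u u' v v' : List α} (h : ChainLe r u u')
    (h' : ChainLe r v v') : ChainLe r (u ++ v) (u' ++ v') := by
  intro l h₁ h₂
  obtain ⟨l₁, l₂, rfl, s₁, s₂⟩ := List.sublist_append_iff.1 h₁
  rw [List.pairwise_append] at h₂
  obtain ⟨p₁, p₂, p₃⟩ := h₂
  obtain ⟨m₁, a₁, a₂, a₃, a₄, a₅⟩ := h l₁ s₁ p₁
  obtain ⟨m₂, b₁, b₂, b₃, b₄, b₅⟩ := h' l₂ s₂ p₂
  refine ⟨m₁ ++ m₂, a₁.append b₁, ?_, by simp [a₃, b₃], ?_, ?_⟩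
  · rw [List.pairwise_append]
    -- Upper bounds first pass from `l₁` to `m₁`; then every element of `m₁` is a lower bound of
    -- `l₂`, hence of `m₂`.
    exact ⟨a₂, b₂, fun a ha b hb => b₄ a (fun c hc => a₅ c (fun d hd => p₃ d hd c hc) a ha) b hb⟩
  · intro a k b hb
    rcases List.mem_append.1 hb with hb | hb
    · exact a₄ a (fun c hc => k c (List.mem_append_left _ hc)) b hb
    · exact b₄ a (fun c hc => k c (List.mem_append_right _ hc)) b hb
  · intro a k b hb
    rcases List.mem_append.1 hb with hb | hb
    · exact a₅ a (fun c hc => k c (List.mem_append_left _ hc)) b hb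
    · exact b₅ a (fun c hc => k c (List.mem_append_right _ hc)) b hb

theorem sublist_triple {l : List α} {a b c : α} (h : l.Sublist [a, b, c]) :
    l = [] ∨ l = [a] ∨ l = [b] ∨ l = [c] ∨ l = [a, b] ∨ l = [a, c] ∨ l = [b, c] ∨
      l = [a, b, c] := by
  have := List.mem_sublists.2 h
  simp [List.sublists] at this
  tauto

/-- Only chains using both `b` and `c` are destroyed. The full triple is excluded by `h'`, and the
pair `b, c` is replaced by `a, c`, whose bounds are controlled by `h`. -/
theorem chainLe_swap_last {r : α → α → Prop} {a b c : α}
    (h : r b c → r a c ∧ (∀ d, r d b → r d a) ∧ ∀ d, r c d → r a d) (h' : r a b → ¬ r b c) :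
    ChainLe r [a, b, c] [a, c, b] := by
  intro l hl hp
  rcases sublist_triple hl with rfl | rfl | rfl | rfl | rfl | rfl | rfl | rfl
  · exact ChainLe.refl _ _ _ (by simp) hp
  · exact ChainLe.refl _ _ _ (by simp) hp
  · exact ChainLe.refl _ _ _ (by simp) hp
  · exact ChainLe.refl _ _ _ (by simp) hp
  · exact ChainLe.refl _ _ _ (by simp) hp
  · exact ChainLe.refl _ _ _ ((List.sublist_append_left [a, c] [b])) hp
  · obtain ⟨h₁, h₂, h₃⟩ := h (by simpa using hp)
    refine ⟨[a, c], List.sublist_append_left [a, c] [b], by simpa, rfl, ?_, ?_⟩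
    · intro d hd
      simp only [List.mem_cons, List.not_mem_nil, or_false, forall_eq_or_imp, forall_eq] at hd ⊢
      exact ⟨h₂ d hd.1, hd.2⟩
    · intro d hd
      simp only [List.mem_cons, List.not_mem_nil, or_false, forall_eq_or_imp, forall_eq] at hd ⊢
      exact ⟨h₃ d hd.2, hd.2⟩
  · simp only [List.pairwise_cons, List.mem_cons, List.not_mem_nil, or_false, forall_eq_or_imp,
      forall_eq] at hp
    exact absurd hp.2.1 (h' hp.1.1)

/-- The mirror case: the destroyed pair `a, b` is replaced by `a, c` or, as a set of bounds, `b` is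
traded for the witness `c`. -/
theorem chainLe_swap_first {r : α → α → Prop} {a b c : α}
    (h : r a b → r a c ∧ (∀ d, r b d → r c d) ∧ ∀ d, r d a → r d c) (h' : r a b → ¬ r b c) :
    ChainLe r [a, b, c] [b, a, c] := by
  intro l hl hp
  rcases sublist_triple hl with rfl | rfl | rfl | rfl | rfl | rfl | rfl | rfl
  · exact ChainLe.refl _ _ _ (by simp) hp
  · exact ChainLe.refl _ _ _ (by simp) hp
  · exact ChainLe.refl _ _ _ (by simp) hp
  · exact ChainLe.refl _ _ _ (by simp) hp
  · obtain ⟨h₁, h₂, h₃⟩ := h (by simpa using hp)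
    refine ⟨[a, c], List.sublist_cons_self b [a, c], by simpa, rfl, ?_, ?_⟩
    · intro d hd
      simp only [List.mem_cons, List.not_mem_nil, or_false, forall_eq_or_imp, forall_eq] at hd ⊢
      exact ⟨hd.1, h₃ d hd.1⟩
    · intro d hd
      simp only [List.mem_cons, List.not_mem_nil, or_false, forall_eq_or_imp, forall_eq] at hd ⊢
      exact ⟨hd.1, h₂ d hd.2⟩
  · exact ChainLe.refl _ _ _ (by simp) hp
  · exact ChainLe.refl _ _ _ (List.Sublist.cons_cons b (List.sublist_cons_self a [c])) hp
  · simp only [List.pairwise_cons, List.mem_cons, List.not_mem_nil, or_false, forall_eq_or_imp,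
      forall_eq] at hp
    exact absurd hp.2.1 (h' hp.1.1)

variable [LinearOrder α]

/-- The words `w` and `w'` have the same lengths of increasing and of decreasing subwords, in every
context. -/
structure ChainEquiv (w w' : List α) : Prop where
  lt : ChainLe (· < ·) w w'
  lt' : ChainLe (· < ·) w' w
  gt : ChainLe (· > ·) w w'
  gt' : ChainLe (· > ·) w' w

theorem ChainEquiv.refl (w : List α) : ChainEquiv w w :=
  ⟨.refl _ _, .refl _ _, .refl _ _, .refl _ _⟩

theorem ChainEquiv.trans {w₁ w₂ w₃ : List α} (h : ChainEquiv w₁ w₂) (h' : ChainEquiv w₂ w₃) :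
    ChainEquiv w₁ w₃ :=
  ⟨h.lt.trans h'.lt, h'.lt'.trans h.lt', h.gt.trans h'.gt, h'.gt'.trans h.gt'⟩

theorem ChainEquiv.append {u u' v v' : List α} (h : ChainEquiv u u') (h' : ChainEquiv v v') :
    ChainEquiv (u ++ v) (u' ++ v') :=
  ⟨h.lt.append h'.lt, h.lt'.append h'.lt', h.gt.append h'.gt, h.gt'.append h'.gt'⟩

theorem ChainEquiv.cons {v v' : List α} (a : α) (h : ChainEquiv v v') :
    ChainEquiv (a :: v) (a :: v') :=
  (ChainEquiv.refl [a]).append h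

/-- The neighbouring letter `y` lies between the exchanged letters `x` and `z`, so in a broken pair
it can stand in for one of them without spoiling any bound. -/
theorem chainEquiv_knuth₁ {x y z : α} (hxy : x < y) (hyz : y < z) :
    ChainEquiv [y, z, x] [y, x, z] := by
  constructor
  · exact chainLe_swap_last (fun h => absurd (hxy.trans hyz) h.not_gt)
      fun _ => (hxy.trans hyz).not_gt
  · exact chainLe_swap_last (fun _ => ⟨hyz, fun _ h => h.trans hxy, fun _ h => hyz.trans h⟩)
      fun h => absurd h hxy.not_gt
  · exact chainLe_swap_last (fun _ => ⟨hxy, fun _ h => hyz.trans h, fun _ h => h.trans hxy⟩)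
      fun h => absurd h hyz.not_gt
  · exact chainLe_swap_last (fun h => absurd (hxy.trans hyz) h.not_gt)
      fun _ => (hxy.trans hyz).not_gt

theorem chainEquiv_knuth₂ {x y z : α} (hxy : x < y) (hyz : y < z) :
    ChainEquiv [x, z, y] [z, x, y] := by
  constructor
  · exact chainLe_swap_first (fun _ => ⟨hxy, fun _ h => hyz.trans h, fun _ h => h.trans hxy⟩)
      fun _ => hyz.not_gt
  · exact chainLe_swap_first (fun h => absurd (hxy.trans hyz) h.not_gt)
      fun h => absurd h (hxy.trans hyz).not_gt
  · exact chainLe_swap_first (fun h => absurd (hxy.trans hyz) h.not_gt)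
      fun h => absurd h (hxy.trans hyz).not_gt
  · exact chainLe_swap_first (fun _ => ⟨hyz, fun _ h => h.trans hxy, fun _ h => hyz.trans h⟩)
      fun _ => hxy.not_gt

end Chains

/-! ### Row insertion preserves tableaux and acts by Knuth moves -/

section Insertion

variable {α : Type*}

/-- The rows of a tableau, read from bottom to top. -/
def readingWord : List (List α) → List α
  | [] => []
  | row :: rows => readingWord rows ++ row

theorem headD_subset_readingWord (T : List (List α)) : T.headD [] ⊆ readingWord T := by
  cases T with
  | nil => simp
  | cons row rows => exact List.subset_append_right _ _

variable [LinearOrder α]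

theorem rowInsert_perm (x : α) (row : List α) :
    ((rowInsert x row).2.toList ++ (rowInsert x row).1).Perm (x :: row) := by
  induction row with
  | nil => simp [rowInsert]
  | cons a ys ih =>
    rw [rowInsert]
    split_ifs with h
    · simpa using List.Perm.swap _ _ _
    · exact (List.perm_middle.trans (ih.cons a)).trans (List.Perm.swap _ _ _)

theorem rowInsert_none {x : α} {row : List α} (h : (rowInsert x row).2 = none) :
    (rowInsert x row).1 = row ++ [x] := by
  induction row with
  | nil => simp [rowInsert]
  | cons a ys ih =>
    rw [rowInsert] at h ⊢
    split_ifs at h ⊢ with h'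
    simp [ih h]

theorem rowInsert_sorted {x : α} {row : List α} (hs : row.Pairwise (· < ·)) (hx : x ∉ row) :
    (rowInsert x row).1.Pairwise (· < ·) := by
  induction row with
  | nil => simp [rowInsert]
  | cons a ys ih =>
    rw [List.pairwise_cons] at hs
    simp only [List.mem_cons, not_or] at hx
    rw [rowInsert]
    split_ifs with h
    · exact List.pairwise_cons.2 ⟨fun b hb => h.trans (hs.1 b hb), hs.2⟩
    · refine List.pairwise_cons.2 ⟨fun b hb => ?_, ih hs.2 hx.2⟩
      have := (rowInsert_perm x ys).subset (List.mem_append_right _ hb)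
      rcases List.mem_cons.1 this with rfl | hb
      · exact lt_of_le_of_ne (not_lt.1 h) (Ne.symm hx.1)
      · exact hs.1 b hb

theorem rowInsert_some {x y : α} {row : List α} (hs : row.Pairwise (· < ·))
    (h : (rowInsert x row).2 = some y) : x < y ∧ y ∈ row ∧ ∀ z ∈ row, z < y → z ≤ x := by
  induction row with
  | nil => simp [rowInsert] at h
  | cons a ys ih =>
    rw [List.pairwise_cons] at hs
    rw [rowInsert] at h
    split_ifs at h with h'
    · simp only [Option.some.injEq] at h
      subst h
      refine ⟨h', by simp, fun z hz hlt => ?_⟩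
      rcases List.mem_cons.1 hz with rfl | hz
      · exact absurd hlt (lt_irrefl _)
      · exact absurd hlt (hs.1 z hz).not_gt
    · obtain ⟨h₁, h₂, h₃⟩ := ih hs.2 h
      refine ⟨h₁, by simp [h₂], fun z hz hlt => ?_⟩
      rcases List.mem_cons.1 hz with rfl | hz
      · exact not_lt.1 h'
      · exact h₃ z hz hlt

/-- The letter `x` travels left past the larger letters, one Knuth move at a time; at each move the
left neighbour of the letter passed lies between the two in value. -/
theorem chainEquiv_move_left {x a : α} {ys : List α} (hx : x < a)
    (hs : (a :: ys).Pairwise (· < ·)) : ChainEquiv (a :: (ys ++ [x])) (a :: x :: ys) := by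
  induction ys generalizing a with
  | nil => exact .refl _
  | cons b ys ih =>
    have hab : a < b := (List.pairwise_cons.1 hs).1 b (by simp)
    exact ((ih (hx.trans hab) (List.pairwise_cons.1 hs).2).cons a).trans
      ((chainEquiv_knuth₁ hx hab).append (.refl ys))

/-- First `x` moves left to its place in the row, next to the bumped `y`; then `y` moves left to the
front by the second Knuth relation. -/
theorem chainEquiv_rowInsert {x y : α} {row : List α} (hs : row.Pairwise (· < ·)) (hx : x ∉ row)
    (h : (rowInsert x row).2 = some y) :
    ChainEquiv (row ++ [x]) (y :: (rowInsert x row).1) := by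
  induction row with
  | nil => simp [rowInsert] at h
  | cons a ys ih =>
    have hs' := List.pairwise_cons.1 hs
    simp only [List.mem_cons, not_or] at hx
    have hsort := rowInsert_sorted hs (x := x) (by simp [hx])
    rw [rowInsert] at h hsort ⊢
    split_ifs at h hsort ⊢ with h'
    · simp only [Option.some.injEq] at h
      subst h
      exact chainEquiv_move_left h' hs
    · refine ((ih hs'.2 hx.2 h).cons a).trans ?_
      have hy := rowInsert_some hs'.2 h
      have hsort' := rowInsert_sorted hs'.2 hx.2
      have hxmem : x ∈ (rowInsert x ys).1 := by
        have := (rowInsert_perm x ys).mem_iff.2 (List.mem_cons_self (a := x) (l := ys))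
        rw [h] at this
        simpa [hy.1.ne] using this
      simp only at h hsort ⊢
      cases hr : (rowInsert x ys).1 with
      | nil => simp [hr] at hxmem
      | cons b t =>
        rw [hr] at hsort hsort' hxmem
        have hab : a < b := (List.pairwise_cons.1 hsort).1 b (by simp)
        have hbx : b ≤ x := by
          rcases List.mem_cons.1 hxmem with rfl | hm
          · exact le_rfl
          · exact ((List.pairwise_cons.1 hsort').1 x hm).le
        -- The letter `b` that follows `y` satisfies `a < b ≤ x < y`, so it is the witness for
        -- exchanging `a` and `y`.
        exact (chainEquiv_knuth₂ hab (hbx.trans_lt hy.1)).append (.refl t)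

/-- The upper row dominates the lower one: in every column in which the lower row has an entry,
the upper row has a smaller entry. -/
def Dominates (upper lower : List α) : Prop :=
  ∀ z, lower.countP (· ≤ z) ≤ upper.countP (· < z)

/-- The rows are nonempty and increasing, and the columns are increasing. -/
def IsTableau : List (List α) → Prop
  | [] => True
  | row :: rows =>
    row ≠ [] ∧ row.Pairwise (· < ·) ∧ Dominates row (rows.headD []) ∧ IsTableau rows

theorem readingWord_tableauInsert_perm (x : α) (T : List (List α)) :
    (readingWord (tableauInsert x T)).Perm (readingWord T ++ [x]) := by
  induction T generalizing x with
  | nil => simp [tableauInsert, readingWord]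
  | cons row rows ih =>
    rw [tableauInsert, readingWord]
    have hp := rowInsert_perm x row
    split
    next h =>
      rw [readingWord, rowInsert_none h, List.append_assoc]
    next y h =>
      rw [readingWord]
      rw [h] at hp
      refine ((ih y).append_right _).trans ?_
      rw [List.append_assoc, List.append_assoc]
      exact (hp.trans (List.perm_append_singleton x row).symm).append_left _

theorem headD_tableauInsert (x : α) (T : List (List α)) :
    (tableauInsert x T).headD [] = (rowInsert x (T.headD [])).1 := by
  cases T with
  | nil => simp [tableauInsert, rowInsert]
  | cons row rows =>
    rw [tableauInsert]
    split <;> simp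

theorem IsTableau.headD_sorted {T : List (List α)} (h : IsTableau T) :
    (T.headD []).Pairwise (· < ·) := by
  cases T with
  | nil => simp
  | cons row rows => exact h.2.1

theorem countP_lt_mono (l : List α) {y z : α} (h : y ≤ z) :
    l.countP (· < y) ≤ l.countP (· < z) :=
  List.countP_mono_left fun a _ ha => by
    simp only [decide_eq_true_eq] at ha ⊢
    exact ha.trans_le h

/-- In the upper row `y` is replaced by the smaller `x`, so its counts never drop, and they gain one
exactly for thresholds `z` with `x < z ≤ y`. This gain pays for `y` in the lower row. -/
theorem dominates_rowInsert {x y : α} {upper lower : List α} (hu : upper.Pairwise (· < ·))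
    (hl : lower.Pairwise (· < ·)) (hyl : y ∉ lower) (hd : Dominates upper lower)
    (hy : (rowInsert x upper).2 = some y) :
    Dominates (rowInsert x upper).1 (rowInsert y lower).1 := by
  intro z
  obtain ⟨hxy, -, -⟩ := rowInsert_some hu hy
  have hup : ∀ z, (rowInsert x upper).1.countP (· < z) + (if y < z then 1 else 0) =
      upper.countP (· < z) + (if x < z then 1 else 0) := by
    intro z
    have := (rowInsert_perm x upper).countP_eq (· < z)
    rw [hy] at this
    simp only [Option.toList_some, List.singleton_append, List.countP_cons, decide_eq_true_eq]
      at this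
    exact this
  -- At the threshold `y` itself the new upper row has one entry more than the old one; monotonicity
  -- carries this to `z` while the lower count stays constant.
  have key : lower.countP (· ≤ z) = lower.countP (· ≤ y) → y ≤ z →
      lower.countP (· ≤ z) + 1 ≤ (rowInsert x upper).1.countP (· < z) := by
    intro h₁ h₂
    have h₃ := hup y
    simp only [lt_irrefl, if_false, hxy, if_true] at h₃
    have h₄ := countP_lt_mono (rowInsert x upper).1 h₂
    have h₅ := hd y
    omega
  have easy : lower.countP (· ≤ z) ≤ (rowInsert x upper).1.countP (· < z) := by
    have h₁ := hup z
    have h₂ := hd z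
    by_cases h₃ : y < z
    · have := hxy.trans h₃
      simp_all
    · simp only [h₃, if_false] at h₁
      omega
  cases hr : (rowInsert y lower).2 with
  | none =>
    rw [rowInsert_none hr, List.countP_append, List.countP_singleton]
    by_cases h : y ≤ z
    · simp only [h, decide_true, if_true]
      refine key (List.countP_congr fun a ha => ?_) h
      have : a < y := by
        have hs := rowInsert_sorted hl hyl
        rw [rowInsert_none hr, List.pairwise_append] at hs
        exact hs.2.2 a ha y (by simp)
      simp [this.le, this.le.trans h]
    · simpa [h] using easy
  | some y₂ =>
    obtain ⟨h₁, -, h₃⟩ := rowInsert_some hl hr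
    have hlo := (rowInsert_perm y lower).countP_eq (· ≤ z)
    rw [hr] at hlo
    simp only [Option.toList_some, List.singleton_append, List.countP_cons, decide_eq_true_eq]
      at hlo
    by_cases h : y ≤ z
    · by_cases h' : y₂ ≤ z
      · simp only [h, h', if_true] at hlo
        omega
      -- Here `y ≤ z < y₂`: the lower row gains `y` without losing a counted entry, but it has no
      -- old entries in `(y, z]`, so `key` applies.
      · simp only [h, h', if_true, if_false] at hlo
        have := key (List.countP_congr fun a ha => ?_) h
        · omega
        · simp only [decide_eq_true_eq]
          exact ⟨fun k => h₃ a ha (k.trans_lt (not_le.1 h')), fun k => k.trans h⟩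
    · have h' : ¬ y₂ ≤ z := fun k => h (h₁.le.trans k)
      simp only [h, h', if_false] at hlo
      omega

theorem IsTableau.tableauInsert {x : α} {T : List (List α)} (hT : IsTableau T)
    (hnd : (readingWord T ++ [x]).Nodup) : IsTableau (tableauInsert x T) := by
  induction T generalizing x with
  | nil => simp [JumpPerm.tableauInsert, IsTableau, Dominates]
  | cons row rows ih =>
    obtain ⟨h₁, h₂, h₃, h₄⟩ := hT
    rw [readingWord] at hnd
    have hx : x ∉ row := by
      intro hx
      exact (List.nodup_append'.1 hnd).2.2 (List.mem_append_right _ hx) (by simp)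
    have hsort := rowInsert_sorted h₂ hx
    have hp := rowInsert_perm x row
    rw [JumpPerm.tableauInsert]
    split
    next h =>
      rw [rowInsert_none h] at hsort ⊢
      refine ⟨by simp, hsort, fun z => (h₃ z).trans ?_, h₄⟩
      simp
    next y h =>
      rw [h] at hp
      have hnd' : (readingWord rows ++ [y] ++ (rowInsert x row).1).Nodup := by
        rw [List.append_assoc] at hnd ⊢
        exact ((hp.trans (List.perm_append_singleton x row).symm).append_left _).nodup_iff.2 hnd
      have hnd'' := (List.nodup_append'.1 hnd').1
      refine ⟨?_, hsort, ?_, ih h₄ hnd''⟩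
      · intro h0
        have := hp.length_eq
        rw [h0] at this
        cases row <;> simp_all
      · rw [headD_tableauInsert]
        refine dominates_rowInsert h₂ h₄.headD_sorted (fun hy => ?_) h₃ h
        exact (List.nodup_append'.1 hnd'').2.2 (headD_subset_readingWord rows hy) (by simp)

theorem chainEquiv_tableauInsert {x : α} {T : List (List α)} (hT : IsTableau T)
    (hnd : (readingWord T ++ [x]).Nodup) :
    ChainEquiv (readingWord T ++ [x]) (readingWord (tableauInsert x T)) := by
  induction T generalizing x with
  | nil => simpa [JumpPerm.tableauInsert, readingWord] using ChainEquiv.refl [x]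
  | cons row rows ih =>
    obtain ⟨h₁, h₂, h₃, h₄⟩ := hT
    rw [readingWord] at hnd ⊢
    have hx : x ∉ row := by
      intro hx
      exact (List.nodup_append'.1 hnd).2.2 (List.mem_append_right _ hx) (by simp)
    have hp := rowInsert_perm x row
    rw [JumpPerm.tableauInsert]
    split
    next h =>
      rw [rowInsert_none h, readingWord, List.append_assoc]
      exact .refl _
    next y h =>
      rw [h] at hp
      have hnd' : (readingWord rows ++ [y] ++ (rowInsert x row).1).Nodup := by
        rw [List.append_assoc] at hnd ⊢
        exact ((hp.trans (List.perm_append_singleton x row).symm).append_left _).nodup_iff.2 hnd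
      have hnd'' := (List.nodup_append'.1 hnd').1
      rw [readingWord, List.append_assoc]
      refine ((ChainEquiv.refl (readingWord rows)).append (chainEquiv_rowInsert h₂ hx h)).trans ?_
      have := (ih h₄ hnd'').append (ChainEquiv.refl (rowInsert x row).1)
      simpa using this

theorem insertionTableau_append_singleton (w : List α) (x : α) :
    insertionTableau (w ++ [x]) = tableauInsert x (insertionTableau w) := by
  simp [insertionTableau]

/-- The insertion tableau of a word without repetitions is a tableau, whose reading word has the
letters of the given word and the same lengths of increasing and decreasing subwords. -/
theorem insertionTableau_spec {w : List α} (hw : w.Nodup) :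
    IsTableau (insertionTableau w) ∧ (readingWord (insertionTableau w)).Perm w ∧
      ChainEquiv w (readingWord (insertionTableau w)) := by
  induction w using List.reverseRecOn with
  | nil => exact ⟨trivial, .refl _, .refl _⟩
  | append_singleton w x ih =>
    obtain ⟨h₁, h₂, h₃⟩ := ih (List.nodup_append'.1 hw).1
    rw [insertionTableau_append_singleton]
    have hp := h₂.append_right [x]
    have hnd := hp.nodup_iff.2 hw
    exact ⟨h₁.tableauInsert hnd, (readingWord_tableauInsert_perm x _).trans hp,
      (h₃.append (.refl [x])).trans (chainEquiv_tableauInsert h₁ hnd)⟩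

end Insertion

end JumpPerm

/-! ### Schensted's theorem for two columns -/

namespace JumpPerm

section Shape

variable {α : Type*}

/-- The word `w` has an `r`-chain of length `k` as a subword. -/
def HasChain (r : α → α → Prop) (w : List α) (k : ℕ) : Prop :=
  ∃ l : List α, l.Sublist w ∧ l.Pairwise r ∧ l.length = k

theorem HasChain.of_le {r : α → α → Prop} {w : List α} {k m : ℕ} (h : HasChain r w m)
    (hk : k ≤ m) : HasChain r w k := by
  obtain ⟨l, h₁, h₂, rfl⟩ := h
  exact ⟨l.take k, (l.take_sublist k).trans h₁, h₂.sublist (l.take_sublist k), by simpa⟩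

theorem HasChain.of_chainLe {r : α → α → Prop} {w w' : List α} {k : ℕ} (h : HasChain r w k)
    (hw : ChainLe r w w') : HasChain r w' k := by
  obtain ⟨l, h₁, h₂, rfl⟩ := h
  obtain ⟨l', h₁', h₂', h₃', -⟩ := hw l h₁ h₂
  exact ⟨l', h₁', h₂', h₃'⟩

variable [LinearOrder α]

/-- A decreasing subword takes at most one letter from each increasing row. -/
theorem length_le_of_hasChain_gt {T : List (List α)} (hT : IsTableau T) {k : ℕ}
    (h : HasChain (· > ·) (readingWord T) k) : k ≤ T.length := by
  obtain ⟨l, h₁, h₂, rfl⟩ := h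
  induction T generalizing l with
  | nil => simp [readingWord] at h₁; simp [h₁]
  | cons row rows ih =>
    obtain ⟨-, hs, -, hr⟩ := hT
    obtain ⟨l₁, l₂, rfl, s₁, s₂⟩ := List.sublist_append_iff.1 h₁
    rw [List.pairwise_append] at h₂
    have := ih hr l₁ s₁ h₂.1
    have h₃ : l₂.length ≤ 1 := by
      have h₄ := hs.sublist s₂
      match l₂, h₂.2.1, h₄ with
      | [], _, _ => simp
      | [_], _, _ => simp
      | a :: b :: _, h₅, h₆ =>
        have h₇ := (List.pairwise_cons.1 h₅).1 b (by simp)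
        exact absurd h₇ ((List.pairwise_cons.1 h₆).1 b (by simp)).not_gt
    simp only [List.length_append, List.length_cons]
    omega

theorem hasChain_gt_length {T : List (List α)} (hT : IsTableau T) :
    HasChain (· > ·) (readingWord T) T.length := by
  -- The chain is the first column, read upwards. The extra clause compares it with the top row, so
  -- that domination makes the next head smaller than everything in the chain.
  suffices ∃ l : List α, l.Sublist (readingWord T) ∧ l.Pairwise (· > ·) ∧ l.length = T.length ∧
      ∀ a ∈ l, ∃ b ∈ T.headD [], b ≤ a by
    obtain ⟨l, h₁, h₂, h₃, -⟩ := this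
    exact ⟨l, h₁, h₂, h₃⟩
  induction T with
  | nil => exact ⟨[], by simp [readingWord]⟩
  | cons row rows ih =>
    obtain ⟨hne, hs, hd, hr⟩ := hT
    obtain ⟨l, h₁, h₂, h₃, h₄⟩ := ih hr
    match row, hne with
    | h :: t, _ =>
      have hlt : ∀ a ∈ l, h < a := by
        intro a ha
        obtain ⟨b, hb, hba⟩ := h₄ a ha
        have h₅ : 0 < (rows.headD []).countP (· ≤ b) :=
          List.countP_pos_iff.2 ⟨b, hb, by simp⟩
        obtain ⟨c, hc, hcb⟩ := List.countP_pos_iff.1 (h₅.trans_le (hd b))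
        have hcb : c < b := by simpa using hcb
        rcases List.mem_cons.1 hc with rfl | hc
        · exact hcb.trans_le hba
        · exact (((List.pairwise_cons.1 hs).1 c hc).trans hcb).trans_le hba
      refine ⟨l ++ [h], h₁.append (by simp), ?_, by simp [h₃], ?_⟩
      · rw [List.pairwise_append]
        exact ⟨h₂, by simp, by simpa using hlt⟩
      · intro a ha
        refine ⟨h, by simp, ?_⟩
        rcases List.mem_append.1 ha with ha | ha
        · exact (hlt a ha).le
        · exact (List.mem_singleton.1 ha).ge

theorem countP_lt_add_countP_le (l : List α) {y z : α} (h : y ≤ z) :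
    l.countP (· < y) + l.countP (fun b => y < b ∧ b ≤ z) ≤ l.countP (· ≤ z) := by
  induction l with
  | nil => simp
  | cons a t ih =>
    simp only [List.countP_cons, decide_eq_true_eq]
    by_cases h₁ : a < y
    · simp only [h₁, h₁.not_gt, h₁.le.trans h, if_true, false_and, if_false]
      omega
    · by_cases h₂ : a ≤ z
      · simp only [h₁, h₂, if_true, if_false, and_true]
        split_ifs <;> omega
      · simp only [h₁, h₂, if_false, and_false]
        omega

theorem length_le_of_hasChain_lt {T : List (List α)} (hT : IsTableau T) {k : ℕ}
    (h : HasChain (· < ·) (readingWord T) k) : k ≤ (T.headD []).length := by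
  -- Induction needs a threshold: if the part in the lower rows ends with `y`, domination bounds its
  -- length by the number of upper entries below `y`, and the remaining letters are upper entries in
  -- `(y, z]`.
  suffices ∀ (l : List α) (z : α), l.Sublist (readingWord T) → l.Pairwise (· < ·) →
      (∀ a ∈ l, a ≤ z) → l.length ≤ (T.headD []).countP (· ≤ z) by
    obtain ⟨l, h₁, h₂, rfl⟩ := h
    rcases l.eq_nil_or_concat with rfl | ⟨m, z, rfl⟩
    · simp
    · rw [List.concat_eq_append] at h₁ h₂ ⊢
      refine (this (m ++ [z]) z h₁ h₂ fun a ha => ?_).trans List.countP_le_length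
      rw [List.pairwise_append] at h₂
      rcases List.mem_append.1 ha with ha | ha
      · exact (h₂.2.2 a ha z (by simp)).le
      · exact (List.mem_singleton.1 ha).le
  clear h k
  induction T with
  | nil =>
    intro l z h
    simp [readingWord] at h
    simp [h]
  | cons row rows ih =>
    obtain ⟨-, hs, hd, hr⟩ := hT
    intro l z h₁ h₂ h₃
    obtain ⟨l₁, l₂, rfl, s₁, s₂⟩ := List.sublist_append_iff.1 h₁
    rw [List.pairwise_append] at h₂
    obtain ⟨p₁, p₂, p₃⟩ := h₂
    rw [List.length_append, List.headD_cons]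
    have hl₂ : ∀ p : α → Bool, (∀ b ∈ l₂, p b) → l₂.length ≤ row.countP p := fun p hp => by
      rw [← List.countP_eq_length.2 hp]
      exact s₂.countP_le
    rcases l₁.eq_nil_or_concat with rfl | ⟨m, y, rfl⟩
    · simpa using hl₂ (· ≤ z) fun b hb => by simpa using h₃ b (by simp [hb])
    · rw [List.concat_eq_append] at *
      have hy : ∀ a ∈ m ++ [y], a ≤ y := fun a ha => by
        rw [List.pairwise_append] at p₁
        rcases List.mem_append.1 ha with ha | ha
        · exact (p₁.2.2 a ha y (by simp)).le
        · exact (List.mem_singleton.1 ha).le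
      have hyz : y ≤ z := h₃ y (by simp)
      have h₄ := (ih hr (m ++ [y]) y s₁ p₁ hy).trans (hd y)
      have h₅ := hl₂ (fun b => y < b ∧ b ≤ z) fun b hb => by
        simpa using ⟨p₃ y (by simp) b hb, h₃ b (by simp [hb])⟩
      have h₆ := countP_lt_add_countP_le row hyz
      omega

theorem hasChain_lt_length_headD {T : List (List α)} (hT : IsTableau T) :
    HasChain (· < ·) (readingWord T) (T.headD []).length := by
  cases T with
  | nil => exact ⟨[], by simp [readingWord]⟩
  | cons row rows => exact ⟨row, List.sublist_append_right _ _, hT.2.1, rfl⟩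

theorem Dominates.length_le {upper lower : List α} (hl : lower.Pairwise (· < ·))
    (hd : Dominates upper lower) : lower.length ≤ upper.length := by
  rcases lower.eq_nil_or_concat with rfl | ⟨m, z, rfl⟩
  · simp
  · rw [List.concat_eq_append] at *
    have : (m ++ [z]).countP (· ≤ z) = (m ++ [z]).length := List.countP_eq_length.2 fun a ha => by
      rw [List.pairwise_append] at hl
      rcases List.mem_append.1 ha with ha | ha
      · simpa using (hl.2.2 a ha z (by simp)).le
      · simpa using (List.mem_singleton.1 ha).le
    rw [← this]
    exact (hd z).trans List.countP_le_length

theorem IsTableau.rowLens_sorted {T : List (List α)} (hT : IsTableau T) :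
    (T.map List.length).Pairwise (· ≥ ·) ∧ (∀ x ∈ T.map List.length, 0 < x) ∧
      ∀ x ∈ T.map List.length, x ≤ (T.headD []).length := by
  induction T with
  | nil => simp
  | cons row rows ih =>
    obtain ⟨hne, hs, hd, hr⟩ := hT
    obtain ⟨h₁, h₂, h₃⟩ := ih hr
    have h₄ := hd.length_le hr.headD_sorted
    refine ⟨List.pairwise_cons.2 ⟨fun x hx => (h₃ x hx).trans h₄, h₁⟩, ?_, ?_⟩
    · intro x hx
      rcases List.mem_cons.1 hx with rfl | hx
      · exact List.length_pos_iff.2 hne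
      · exact h₂ x hx
    · intro x hx
      rcases List.mem_cons.1 hx with rfl | hx
      · rfl
      · exact (h₃ x hx).trans h₄

end Shape

theorem length_readingWord {α : Type*} (T : List (List α)) :
    (readingWord T).length = (T.map List.length).sum := by
  induction T with
  | nil => rfl
  | cons row rows ih => simp [readingWord, ih, add_comm]

theorem sublist_ofFn_iff {α : Type*} {n : ℕ} {f : Fin n → α} {l : List α} :
    l.Sublist (List.ofFn f) ↔ ∃ m : List (Fin n), m.Pairwise (· < ·) ∧ l = m.map f := by
  rw [List.ofFn_eq_map, List.sublist_map_iff]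
  constructor
  · rintro ⟨m, h, rfl⟩
    exact ⟨m, (List.pairwise_lt_finRange n).sublist h, rfl⟩
  · rintro ⟨m, h, rfl⟩
    refine ⟨m, List.sublist_of_subperm_of_pairwise (r := (· ≤ ·)) ?_ (h.imp le_of_lt)
      ((List.pairwise_lt_finRange n).imp le_of_lt), rfl⟩
    exact List.subperm_of_subset (h.imp ne_of_lt) fun a _ => List.mem_finRange a

theorem hasChain_ofFn_iff {α : Type*} {n : ℕ} {f : Fin n → α} {r : α → α → Prop} {k : ℕ} :
    HasChain r (List.ofFn f) k ↔
      ∃ A : Finset (Fin n), A.card = k ∧ ∀ i ∈ A, ∀ j ∈ A, i < j → r (f i) (f j) := by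
  constructor
  · rintro ⟨l, h₁, h₂, rfl⟩
    obtain ⟨m, hm, rfl⟩ := sublist_ofFn_iff.1 h₁
    refine ⟨m.toFinset, by simp [List.toFinset_card_of_nodup (hm.imp ne_of_lt)], ?_⟩
    intro i hi j hj hij
    rw [List.mem_toFinset] at hi hj
    rw [List.pairwise_map] at h₂
    obtain ⟨a, ha, rfl⟩ := List.mem_iff_getElem.1 hi
    obtain ⟨b, hb, rfl⟩ := List.mem_iff_getElem.1 hj
    have hab : a < b := by
      by_contra hab
      rcases (not_lt.1 hab).eq_or_lt with rfl | h
      · exact lt_irrefl _ hij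
      · exact lt_asymm hij (List.pairwise_iff_getElem.1 hm b a hb ha h)
    exact List.pairwise_iff_getElem.1 h₂ a b ha hb hab
  · rintro ⟨A, rfl, h⟩
    have hs := A.sortedLT_sort.pairwise
    refine ⟨A.sort.map f, sublist_ofFn_iff.2 ⟨_, hs, rfl⟩, ?_, by simp⟩
    rw [List.pairwise_map]
    exact hs.imp_of_mem fun ha hb hab => h _ (by simpa using ha) _ (by simpa using hb) hab

theorem hasChain_ofFn_three_iff {α : Type*} {n : ℕ} {f : Fin n → α} {r : α → α → Prop}
    [IsTrans α r] : HasChain r (List.ofFn f) 3 ↔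
      ∃ i j k : Fin n, i < j ∧ j < k ∧ r (f i) (f j) ∧ r (f j) (f k) := by
  constructor
  · rintro ⟨l, h₁, h₂, h₃⟩
    obtain ⟨m, hm, rfl⟩ := sublist_ofFn_iff.1 h₁
    rw [List.length_map, List.length_eq_three] at h₃
    obtain ⟨i, j, k, rfl⟩ := h₃
    simp at hm h₂
    exact ⟨i, j, k, hm.1.1, hm.2, h₂.1.1, h₂.2⟩
  · rintro ⟨i, j, k, h₁, h₂, h₃, h₄⟩
    refine ⟨[i, j, k].map f, sublist_ofFn_iff.2 ⟨_, ?_, rfl⟩, ?_, rfl⟩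
    · simp [h₁, h₂, h₁.trans h₂]
    · simp [h₃, h₄, _root_.trans h₃ h₄]

/-- A weakly decreasing list of ones and twos is determined by its numbers of ones and twos, hence
by length and sum. -/
theorem eq_of_sorted_of_sum_eq {L L' : List ℕ} (h : L.Pairwise (· ≥ ·)) (h' : L'.Pairwise (· ≥ ·))
    (hL : ∀ x ∈ L, 0 < x ∧ x ≤ 2) (hL' : ∀ x ∈ L', 0 < x ∧ x ≤ 2) (hlen : L.length = L'.length)
    (hsum : L.sum = L'.sum) : L = L' := by
  induction L generalizing L' with
  | nil => exact (List.length_eq_zero_iff.1 hlen.symm).symm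
  | cons a t ih =>
    match L', hlen with
    | b :: t', hlen =>
      rw [List.pairwise_cons] at h h'
      simp only [List.mem_cons, forall_eq_or_imp] at hL hL'
      simp only [List.length_cons, Nat.add_right_cancel_iff] at hlen
      simp only [List.sum_cons] at hsum
      have low : ∀ l : List ℕ, (∀ x ∈ l, 0 < x ∧ x ≤ 2) → l.length ≤ l.sum := fun l hl => by
        simpa using List.card_nsmul_le_sum l 1 fun x hx => (hl x hx).1
      have high : ∀ l : List ℕ, (∀ x ∈ l, 1 ≥ x) → l.sum ≤ l.length := fun l hl => by
        simpa using List.sum_le_card_nsmul l 1 fun x hx => hl x hx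
      have e : a = b := by
        rcases lt_trichotomy a b with hab | hab | hab
        · have ha : a = 1 := by omega
          subst ha
          have := high t h.1
          have := low t' hL'.2
          omega
        · exact hab
        · have hb : b = 1 := by omega
          subst hb
          have := high t' h'.1
          have := low t hL.2
          omega
      subst e
      rw [ih h.2 h'.2 hL.2 hL'.2 hlen (by omega)]

theorem rowLens_of_transpose_rowLens {lam : YoungDiagram} {s r : ℕ}
    (h : lam.transpose.rowLens = [s, r]) :
    lam.rowLens = (List.range s).map fun i => if i < r then 2 else 1 := by
  have h₁ : lam.rowLen 0 = 2 := by
    have := congrArg List.length h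
    simpa using this
  have h₂ : lam.colLen 0 = s ∧ lam.colLen 1 = r := by
    rw [YoungDiagram.rowLens, YoungDiagram.colLen_transpose, h₁] at h
    simpa [List.range_succ] using h
  rw [YoungDiagram.rowLens, h₂.1]
  refine List.map_congr_left fun i hi => ?_
  have h₃ := lam.rowLen_anti 0 i (Nat.zero_le i)
  have h₄ : 0 < lam.rowLen i := by
    rw [← YoungDiagram.mem_iff_lt_rowLen, YoungDiagram.mem_iff_lt_colLen, h₂.1]
    simpa using hi
  have h₅ : 1 < lam.rowLen i ↔ i < r := by
    rw [← YoungDiagram.mem_iff_lt_rowLen, YoungDiagram.mem_iff_lt_colLen, h₂.2]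
  split_ifs with h₆
  · have := h₅.2 h₆
    omega
  · have := mt h₅.1 h₆
    omega

/-- Schensted's theorem for two columns: `π` has the shape with column lengths `s` and `r` if and
only if `π` has no increasing subsequence of length three, and its longest decreasing subsequences
have length `s`. -/
theorem hasShape_iff {s r : ℕ} (hrs : r ≤ s) {lam : YoungDiagram}
    (hlam : lam.transpose.rowLens = [s, r]) (π : Equiv.Perm (Fin (s + r))) :
    HasShape π lam ↔
      (¬ ∃ i j k, i < j ∧ j < k ∧ π i < π j ∧ π j < π k) ∧
      (∃ A : Finset (Fin (s + r)), A.card = s ∧ ∀ i ∈ A, ∀ j ∈ A, i < j → π j < π i) ∧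
      ∀ A : Finset (Fin (s + r)), (∀ i ∈ A, ∀ j ∈ A, i < j → π j < π i) → A.card ≤ s := by
  obtain ⟨hT, hperm, heq⟩ := insertionTableau_spec (List.nodup_ofFn.2 π.injective)
  have hrow := rowLens_of_transpose_rowLens hlam
  obtain ⟨t₁, t₂, t₃⟩ := hT.rowLens_sorted
  have hsum := hperm.length_eq
  rw [length_readingWord, List.length_ofFn] at hsum
  have hrsum : lam.rowLens.sum = s + r := by
    rw [hrow]
    have : ∀ s, ((List.range s).map fun i => if i < r then 2 else 1).sum = s + min s r := by
      intro s
      induction s with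
      | zero => simp
      | succ s ih =>
        rw [List.range_succ, List.map_append, List.sum_append, ih]
        simp only [List.map_cons, List.map_nil, List.sum_cons, List.sum_nil]
        split_ifs <;> omega
    rw [this, min_eq_right hrs]
  have hlen : lam.rowLens.length = s := by simp [hrow]
  have hdec : ∀ k, HasChain (· > ·) (List.ofFn fun i => π i) k → k ≤
      (insertionTableau (List.ofFn fun i => π i)).length := fun k hk =>
    length_le_of_hasChain_gt hT (hk.of_chainLe heq.gt)
  have hdec' := (hasChain_gt_length hT).of_chainLe heq.gt'
  have hinc : ∀ k, HasChain (· < ·) (List.ofFn fun i => π i) k → k ≤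
      ((insertionTableau (List.ofFn fun i => π i)).headD []).length := fun k hk =>
    length_le_of_hasChain_lt hT (hk.of_chainLe heq.lt)
  have hinc' := (hasChain_lt_length_headD hT).of_chainLe heq.lt'
  rw [← hasChain_ofFn_three_iff]
  unfold HasShape
  generalize insertionTableau (List.ofFn fun i => π i) = T at *
  constructor
  · intro h
    have hTlen : T.length = s := by
      have := congrArg List.length h
      rwa [List.length_map, hlen] at this
    rw [hTlen] at hdec hdec'
    refine ⟨fun h3 => ?_, hasChain_ofFn_iff.1 hdec', fun A hA =>
      hdec _ (hasChain_ofFn_iff.2 ⟨A, rfl, hA⟩)⟩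
    have h3 := hinc 3 h3
    have : (T.headD []).length ∈ T.map List.length := by
      cases T with
      | nil => simp at h3
      | cons row rows => simp
    rw [h, hrow, List.mem_map] at this
    obtain ⟨i, -, hi⟩ := this
    split_ifs at hi <;> omega
  · rintro ⟨h₁, h₂, h₃⟩
    have hTlen : T.length = s := by
      refine le_antisymm ?_ (hdec s (hasChain_ofFn_iff.2 h₂))
      obtain ⟨A, hA, hA'⟩ := hasChain_ofFn_iff.1 hdec'
      rw [← hA]
      exact h₃ A hA'
    have hhead : (T.headD []).length ≤ 2 := by
      by_contra hcon
      exact h₁ (hinc'.of_le (by omega))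
    -- Rows of length at most two, `s` of them, with `s + r` entries in all, leave only one shape.
    refine eq_of_sorted_of_sum_eq t₁ ?_ (fun x hx => ⟨t₂ x hx, (t₃ x hx).trans hhead⟩) ?_ ?_ ?_
    · exact lam.rowLens_sorted.pairwise
    · intro x hx
      rw [hrow, List.mem_map] at hx
      obtain ⟨i, -, rfl⟩ := hx
      split_ifs <;> simp
    · rw [List.length_map, hTlen, hlen]
    · rw [hsum, hrsum]

end JumpPerm

/-! ### Extremal counting of noninversions -/

namespace JumpPerm

variable {n : ℕ}

/-- The number of pairs of positions whose entries are in increasing order. -/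
def nonInv (π : Equiv.Perm (Fin n)) : ℕ :=
  (Finset.univ.filter fun p : Fin n × Fin n => p.1 < p.2 ∧ π p.1 < π p.2).card

theorem inv_add_nonInv (π : Equiv.Perm (Fin n)) :
    inv π + nonInv π = (Finset.univ.filter fun p : Fin n × Fin n => p.1 < p.2).card := by
  rw [inv, nonInv, ← Finset.card_union_of_disjoint]
  · congr 1
    ext p
    simp only [Finset.mem_union, Finset.mem_filter, Finset.mem_univ, true_and, ← and_or_left,
      and_iff_left_iff_imp]
    intro h
    exact lt_or_gt_of_ne (π.injective.ne h.ne').symm.symm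
  · rw [Finset.disjoint_filter]
    exact fun p _ h h' => lt_asymm h.2 h'.2

/-- The values of `π` decrease along the positions in `A`. -/
def Decreasing (π : Equiv.Perm (Fin n)) (A : Finset (Fin n)) : Prop :=
  ∀ i ∈ A, ∀ j ∈ A, i < j → π j < π i

/-- `π` has an increasing subsequence of length three. -/
def HasIncreasingTriple (π : Equiv.Perm (Fin n)) : Prop :=
  ∃ i j k, i < j ∧ j < k ∧ π i < π j ∧ π j < π k

/-- The positions that are in increasing order with the position `b`. -/
def nonInvNeighbors (π : Equiv.Perm (Fin n)) (b : Fin n) : Finset (Fin n) :=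
  Finset.univ.filter fun i => (b < i ∧ π b < π i) ∨ (i < b ∧ π i < π b)

theorem mem_nonInvNeighbors {π : Equiv.Perm (Fin n)} {b i : Fin n} :
    i ∈ nonInvNeighbors π b ↔ (b < i ∧ π b < π i) ∨ (i < b ∧ π i < π b) := by
  simp [nonInvNeighbors]

/-- An increasing pair of neighbours would form an increasing triple with `b`, wherever `b` stands
relative to them. -/
theorem decreasing_nonInvNeighbors {π : Equiv.Perm (Fin n)} (h : ¬ HasIncreasingTriple π)
    (b : Fin n) : Decreasing π (nonInvNeighbors π b) := by
  intro i hi j hj hij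
  rw [mem_nonInvNeighbors] at hi hj
  by_contra hc
  have hc : π i < π j := lt_of_le_of_ne (not_lt.1 hc) (π.injective.ne hij.ne)
  rcases hi with hi | hi <;> rcases hj with hj | hj
  · exact h ⟨b, i, j, hi.1, hij, hi.2, hc⟩
  · exact lt_asymm hij (hj.1.trans hi.1)
  · exact h ⟨i, b, j, hi.1, hj.1, hi.2, hj.2⟩
  · exact h ⟨i, j, b, hij, hj.1, hc, hj.2⟩

/-- If `π` has no increasing triple and no decreasing subsequence longer than the one at `A`, then
it has at most `|A| |Aᶜ|` noninversions, and in the case of equality every position outside `A` is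
in increasing order with all of `A`. -/
theorem nonInv_le {π : Equiv.Perm (Fin n)} {s : ℕ} (h : ¬ HasIncreasingTriple π)
    {A : Finset (Fin n)} (hA : A.card = s) (hdec : Decreasing π A)
    (hmax : ∀ B, Decreasing π B → B.card ≤ s) :
    nonInv π ≤ Aᶜ.card * s ∧
      (nonInv π = Aᶜ.card * s → ∀ b ∉ A, nonInvNeighbors π b = A) := by
  have hle : ∀ b ∈ Aᶜ, (nonInvNeighbors π b).card ≤ s :=
    fun b _ => hmax _ (decreasing_nonInvNeighbors h b)
  set S : Finset (Σ _ : Fin n, Fin n) := Aᶜ.sigma (nonInvNeighbors π) with hS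
  have hSle : S.card ≤ Aᶜ.card * s := by
    rw [hS, Finset.card_sigma]
    exact (Finset.sum_le_card_nsmul _ _ _ hle).trans_eq (smul_eq_mul _ _)
  -- A noninversion is recorded from an end outside `A`, which exists because `A` is decreasing; if
  -- both ends are outside, from the left one.
  let f : Fin n × Fin n → Σ _ : Fin n, Fin n := fun p =>
    if p.1 ∈ A then ⟨p.2, p.1⟩ else ⟨p.1, p.2⟩
  set E := Finset.univ.filter fun p : Fin n × Fin n => p.1 < p.2 ∧ π p.1 < π p.2 with hE
  have hinj : Set.InjOn f E := by
    rintro ⟨a, b⟩ hp ⟨c, d⟩ hq hpq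
    simp only [hE, Finset.coe_filter, Finset.mem_univ, true_and, Set.mem_ofPred_eq] at hp hq
    simp only [f] at hpq
    split_ifs at hpq with h₁ h₂ h₂
    · simp only [Sigma.mk.injEq, heq_eq_eq] at hpq
      rw [hpq.1, hpq.2]
    · simp only [Sigma.mk.injEq, heq_eq_eq] at hpq
      rw [hpq.1, hpq.2] at hp
      exact absurd hp.1 hq.1.not_gt
    · simp only [Sigma.mk.injEq, heq_eq_eq] at hpq
      rw [hpq.1, hpq.2] at hp
      exact absurd hp.1 hq.1.not_gt
    · simp only [Sigma.mk.injEq, heq_eq_eq] at hpq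
      rw [hpq.1, hpq.2]
  have hsub : E.image f ⊆ S := by
    intro q hq
    obtain ⟨⟨a, b⟩, hp, rfl⟩ := Finset.mem_image.1 hq
    simp only [hE, Finset.mem_filter, Finset.mem_univ, true_and] at hp
    simp only [f]
    split_ifs with h₁
    · simp only [hS, Finset.mem_sigma, Finset.mem_compl, mem_nonInvNeighbors]
      exact ⟨fun h₂ => lt_asymm hp.2 (hdec a h₁ b h₂ hp.1), Or.inr hp⟩
    · simp only [hS, Finset.mem_sigma, Finset.mem_compl, mem_nonInvNeighbors]
      exact ⟨h₁, Or.inl hp⟩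
  have hcard : (E.image f).card = nonInv π := Finset.card_image_of_injOn hinj
  have hES := hcard ▸ Finset.card_le_card hsub
  refine ⟨hES.trans hSle, fun heq b hb => ?_⟩
  have himage : E.image f = S := Finset.eq_of_subset_of_card_le hsub (by rwa [hcard, heq])
  have hsum : ∑ b ∈ Aᶜ, (nonInvNeighbors π b).card = ∑ _b ∈ Aᶜ, s := by
    rw [← Finset.card_sigma, Finset.sum_const, smul_eq_mul]
    exact le_antisymm hSle (heq ▸ hES)
  have hNb := (Finset.sum_eq_sum_iff_of_le hle).1 hsum b (Finset.mem_compl.2 hb)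
  refine Finset.eq_of_subset_of_card_le (fun x hx => ?_) (by omega)
  by_contra hxA
  -- A neighbour pair with both ends outside `A` occurs twice in `S`, once from each end, but `f`
  -- hits only the copy recorded from the left end. Equality of image and `S` therefore excludes
  -- such pairs.
  have key : ∀ c d : Fin n, c ∉ A → d ∉ A → d ∈ nonInvNeighbors π c → c < d := by
    intro c d hc hd hcd
    have : (⟨c, d⟩ : Σ _ : Fin n, Fin n) ∈ E.image f := by
      rw [himage]
      exact Finset.mem_sigma.2 ⟨Finset.mem_compl.2 hc, hcd⟩
    obtain ⟨⟨a, b⟩, hp, hab⟩ := Finset.mem_image.1 this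
    simp only [hE, Finset.mem_filter, Finset.mem_univ, true_and] at hp
    simp only [f] at hab
    split_ifs at hab with h₁
    · simp only [Sigma.mk.injEq, heq_eq_eq] at hab
      exact absurd (hab.2 ▸ h₁) hd
    · simp only [Sigma.mk.injEq, heq_eq_eq] at hab
      rw [← hab.1, ← hab.2]
      exact hp.1
  refine lt_asymm (key b x hb hxA hx) (key x b hxA hb ?_)
  rw [mem_nonInvNeighbors] at hx ⊢
  exact hx.symm

theorem card_filter_perm_lt (π : Equiv.Perm (Fin n)) (v : Fin n) :
    (Finset.univ.filter fun j => π j < v).card = v := by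
  rw [← Fin.card_Iio v, ← Finset.card_map π.toEmbedding]
  congr 1
  ext x
  simp only [Finset.mem_map_equiv, Finset.mem_filter, Finset.mem_univ, true_and,
    Equiv.apply_symm_apply, Finset.mem_Iio]

/-- The set `A` must be an initial segment of positions, and each entry is recovered as the number
of smaller entries. -/
theorem isLayered_of_forall_lt {π : Equiv.Perm (Fin n)} {A : Finset (Fin n)} {c₁ c₂ : ℕ}
    (h₁ : 0 < c₁) (h₂ : 0 < c₂) (hA : A.card = c₁) (hA' : Aᶜ.card = c₂) (hdec : Decreasing π A)
    (hdec' : Decreasing π Aᶜ) (h : ∀ a ∈ A, ∀ b ∉ A, a < b ∧ π a < π b) :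
    IsLayered c₁ c₂ π := by
  have hn : c₁ + c₂ = n := by
    rw [← hA, ← hA', Finset.card_add_card_compl, Fintype.card_fin]
  have hmem : ∀ i : Fin n, i ∈ A ↔ (i : ℕ) < c₁ := by
    intro i
    constructor
    · intro hi
      have : Finset.Iic i ⊆ A := fun j hj => by
        by_contra hjA
        exact absurd (h i hi j hjA).1 (Finset.mem_Iic.1 hj).not_gt
      have := Finset.card_le_card this
      rw [Fin.card_Iic, hA] at this
      omega
    · intro hi
      by_contra hiA
      have : A ⊆ Finset.Iio i := fun j hj => Finset.mem_Iio.2 (h j hj i hiA).1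
      have := Finset.card_le_card this
      rw [Fin.card_Iio, hA] at this
      omega
  refine ⟨h₁, h₂, hn, fun i hi => ?_, fun i hi => ?_⟩
  · have hiA := (hmem i).2 hi
    have hset : (Finset.univ.filter fun j => π j < π i) = A \ Finset.Iic i := by
      ext j
      simp only [Finset.mem_filter, Finset.mem_univ, true_and, Finset.mem_sdiff, Finset.mem_Iic,
        not_le]
      constructor
      · intro hj
        have hjA : j ∈ A := by
          by_contra hjA
          exact lt_asymm hj (h i hiA j hjA).2
        refine ⟨hjA, ?_⟩
        by_contra hij
        rcases (not_lt.1 hij).eq_or_lt with rfl | hij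
        · exact lt_irrefl _ hj
        · exact lt_asymm hj (hdec j hjA i hiA hij)
      · exact fun hj => hdec i hiA j hj.1 hj.2
    have hsub : Finset.Iic i ⊆ A := fun j hj =>
      (hmem j).2 (lt_of_le_of_lt (Fin.le_def.1 (Finset.mem_Iic.1 hj)) hi)
    have := card_filter_perm_lt π (π i)
    rw [hset, Finset.card_sdiff_of_subset hsub, hA, Fin.card_Iic] at this
    omega
  · have hiA : i ∉ A := fun hiA => absurd ((hmem i).1 hiA) (not_lt.2 hi)
    -- In the right block, the entries not below `π i` are exactly those of the block at positions
    -- up to and including `i`.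
    have hset : (Finset.univ.filter fun j => π j < π i) = (Finset.Iic i \ A)ᶜ := by
      ext j
      simp only [Finset.mem_filter, Finset.mem_univ, true_and, Finset.mem_compl,
        Finset.mem_sdiff, Finset.mem_Iic, not_and, not_not]
      constructor
      · intro hj hji
        by_contra hjA
        rcases hji.eq_or_lt with rfl | hji
        · exact lt_irrefl _ hj
        · exact lt_asymm hj (hdec' j (by simpa) i (by simpa) hji)
      · intro hj
        by_cases hjA : j ∈ A
        · exact (h j hjA i hiA).2
        · exact hdec' i (by simpa) j (by simpa) (not_le.1 fun hji => hjA (hj hji))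
    have hsub : A ⊆ Finset.Iic i := fun j hj => Finset.mem_Iic.2 (h j hj i hiA).1.le
    have := card_filter_perm_lt π (π i)
    rw [hset, Finset.card_compl, Finset.card_sdiff_of_subset hsub, hA, Fin.card_Iic,
      Fintype.card_fin] at this
    omega

/-- An element with one noninversion partner before it and another after it is the middle of an
increasing triple, so one comparable pair decides the order of the two blocks everywhere. -/
theorem isLayered_of_nonInvNeighbors {π : Equiv.Perm (Fin n)} {A : Finset (Fin n)} {s r : ℕ}
    (hs : 0 < s) (hr : 0 < r) (h : ¬ HasIncreasingTriple π) (hA : A.card = s) (hA' : Aᶜ.card = r)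
    (hdec : Decreasing π A) (hN : ∀ b ∉ A, nonInvNeighbors π b = A) :
    IsLayered s r π ∨ IsLayered r s π := by
  have hdec' : Decreasing π Aᶜ := by
    intro i hi j hj hij
    rw [Finset.mem_compl] at hi hj
    by_contra hc
    refine hj ?_
    rw [← hN i hi, mem_nonInvNeighbors]
    exact Or.inl ⟨hij, lt_of_le_of_ne (not_lt.1 hc) (π.injective.ne hij.ne)⟩
  have hor : ∀ a ∈ A, ∀ b ∉ A, (b < a ∧ π b < π a) ∨ (a < b ∧ π a < π b) := by
    intro a ha b hb
    rwa [← mem_nonInvNeighbors, hN b hb]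
  obtain ⟨a₀, ha₀⟩ := Finset.card_pos.1 (hA ▸ hs)
  obtain ⟨b₀, hb₀⟩ := Finset.card_pos.1 (hA' ▸ hr)
  rw [Finset.mem_compl] at hb₀
  rcases hor a₀ ha₀ b₀ hb₀ with h₀ | h₀
  · right
    have h₁ : ∀ a ∈ A, b₀ < a ∧ π b₀ < π a := fun a ha =>
      (hor a ha b₀ hb₀).resolve_right fun k => h ⟨a, b₀, a₀, k.1, h₀.1, k.2, h₀.2⟩
    refine isLayered_of_forall_lt hr hs hA' (by rwa [compl_compl]) hdec' (by rwa [compl_compl])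
      fun b hb a ha => ?_
    rw [Finset.mem_compl] at hb
    rw [Finset.mem_compl, not_not] at ha
    exact (hor a ha b hb).resolve_right fun k =>
      h ⟨b₀, a, b, (h₁ a ha).1, k.1, (h₁ a ha).2, k.2⟩
  · left
    have h₁ : ∀ a ∈ A, a < b₀ ∧ π a < π b₀ := fun a ha =>
      (hor a ha b₀ hb₀).resolve_left fun k => h ⟨a₀, b₀, a, h₀.1, k.1, h₀.2, k.2⟩
    refine isLayered_of_forall_lt hs hr hA hA' hdec hdec' fun a ha b hb => ?_
    exact (hor a ha b hb).resolve_left fun k =>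
      h ⟨b, a, b₀, k.1, (h₁ a ha).1, k.2, (h₁ a ha).2⟩

/-- A union of two decreasing sequences has no increasing triple. -/
theorem not_hasIncreasingTriple_of_decreasing {π : Equiv.Perm (Fin n)} {A : Finset (Fin n)}
    (hdec : Decreasing π A) (hdec' : Decreasing π Aᶜ) : ¬ HasIncreasingTriple π := by
  rintro ⟨i, j, k, h₁, h₂, h₃, h₄⟩
  have key : ∀ a b : Fin n, a < b → π a < π b → (a ∈ A ↔ b ∉ A) := by
    intro a b hab hπ
    constructor
    · exact fun ha hb => lt_asymm hπ (hdec a ha b hb hab)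
    · intro hb
      by_contra ha
      exact lt_asymm hπ (hdec' a (by simpa) b (by simpa) hab)
  have e₁ := key i j h₁ h₃
  have e₂ := key j k h₂ h₄
  have e₃ := key i k (h₁.trans h₂) (h₃.trans h₄)
  tauto

/-- If `π` is a union of two decreasing sequences and fewer than `r` pairs between the two are
inversions, then every decreasing sequence has at most `s` elements, where `s ≥ r` bounds the
lengths of the two. -/
theorem card_le_of_decreasing {π : Equiv.Perm (Fin n)} {A B : Finset (Fin n)} {s r : ℕ}
    (hdec : Decreasing π A) (hdec' : Decreasing π Aᶜ) (hA : A.card ≤ s) (hA' : Aᶜ.card ≤ s)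
    (hrs : r ≤ s) (hN : A.card * Aᶜ.card < nonInv π + r) (hB : Decreasing π B) : B.card ≤ s := by
  have hBcard : B.card = (B ∩ A).card + (B ∩ Aᶜ).card := by
    rw [← Finset.sdiff_eq_inter_compl, Finset.card_inter_add_card_sdiff]
  rcases (B ∩ A).card.eq_zero_or_pos with h₀ | h₁
  · have := Finset.card_le_card (Finset.inter_subset_right (s₁ := B) (s₂ := Aᶜ))
    omega
  rcases (B ∩ Aᶜ).card.eq_zero_or_pos with h₀ | h₂
  · have := Finset.card_le_card (Finset.inter_subset_right (s₁ := B) (s₂ := A))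
    omega
  have hle : nonInv π + (B ∩ A).card * (B ∩ Aᶜ).card ≤ A.card * Aᶜ.card := by
    -- Noninversions go between the two blocks, so they embed in `A × Aᶜ`; the pairs inside `B` are
    -- inversions and supply further, disjoint elements.
    let f : Fin n × Fin n → Fin n × Fin n := fun p => if p.1 ∈ A then p else p.swap
    have hmem : ∀ a b : Fin n, a < b → π a < π b → (a ∈ A ↔ b ∉ A) := by
      intro a b hab hπ
      constructor
      · exact fun ha hb => lt_asymm hπ (hdec a ha b hb hab)
      · intro hb
        by_contra ha
        exact lt_asymm hπ (hdec' a (by simpa) b (by simpa) hab)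
    set E := Finset.univ.filter fun p : Fin n × Fin n => p.1 < p.2 ∧ π p.1 < π p.2 with hE
    have hinj : Set.InjOn f E := by
      rintro ⟨a, b⟩ hp ⟨c, d⟩ hq hpq
      simp only [hE, Finset.coe_filter, Finset.mem_univ, true_and, Set.mem_ofPred_eq] at hp hq
      have k₁ := hp.1
      have k₂ := hq.1
      simp only [f] at hpq
      split_ifs at hpq <;> simp only [Prod.mk.injEq, Prod.swap_prod_mk] at hpq ⊢ <;> omega
    have hcard : (E.image f).card = nonInv π := Finset.card_image_of_injOn hinj
    rw [← hcard, ← Finset.card_product, ← Finset.card_product, ← Finset.card_union_of_disjoint]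
    · refine Finset.card_le_card (Finset.union_subset ?_
        (Finset.product_subset_product Finset.inter_subset_right Finset.inter_subset_right))
      intro q hq
      obtain ⟨⟨a, b⟩, hp, rfl⟩ := Finset.mem_image.1 hq
      simp only [hE, Finset.mem_filter, Finset.mem_univ, true_and] at hp
      have := hmem a b hp.1 hp.2
      simp only [f]
      split_ifs with h <;> simp <;> tauto
    · rw [Finset.disjoint_left]
      intro q hq hq'
      obtain ⟨⟨a, b⟩, hp, rfl⟩ := Finset.mem_image.1 hq
      simp only [hE, Finset.mem_filter, Finset.mem_univ, true_and] at hp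
      have : a ∈ B ∧ b ∈ B := by
        simp only [f] at hq'
        split_ifs at hq' <;> simp at hq' <;> tauto
      exact lt_asymm hp.2 (hB a this.1 b this.2 hp.1)
  -- This is `(p - 1) * (q - 1) ≥ 0` for the two positive block counts.
  have : (B ∩ A).card + (B ∩ Aᶜ).card ≤ (B ∩ A).card * (B ∩ Aᶜ).card + 1 := by nlinarith
  omega

end JumpPerm

/-! ### The permutation of a jump diagram -/

namespace JumpPerm

variable {n : ℕ}

theorem adjSwap_apply {i : ℕ} (h₁ : 1 ≤ i) (h₂ : i < n) (v : Fin n) :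
    (adjSwap n i v : ℕ) = if (v : ℕ) + 1 = i then i else if (v : ℕ) = i then i - 1 else v := by
  rw [adjSwap, dif_pos ⟨h₁, h₂⟩, Equiv.swap_apply_def]
  simp only [Fin.ext_iff]
  split_ifs <;> first | rfl | (simp only [*] at *; omega)

/-- The inverse of `t_a t_{a+1} ⋯ t_{a+L-1}` moves the `a`-th element to the right by `L` and the
elements over which it jumps to the left by one. -/
theorem prod_adjSwap_inv_apply {a : ℕ} (ha : 1 ≤ a) (L : ℕ) (hL : a + L ≤ n) (v : Fin n) :
    (((((List.range L).map fun m => adjSwap n (a + m)).prod)⁻¹ v : Fin n) : ℕ) =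
      if (v : ℕ) + 1 = a then v + L else if a ≤ v ∧ (v : ℕ) < a + L then v - 1 else v := by
  induction L with
  | zero =>
    rw [if_neg (c := a ≤ (v : ℕ) ∧ (v : ℕ) < a + 0) (by omega)]
    simp
  | succ L ih =>
    have ih := ih (by omega)
    rw [List.range_succ, List.map_append, List.prod_append, mul_inv_rev, Equiv.Perm.mul_apply]
    have hinv : (adjSwap n (a + L))⁻¹ = adjSwap n (a + L) := by
      rw [adjSwap, dif_pos ⟨by omega, by omega⟩, Equiv.swap_inv]
    simp only [List.map_cons, List.map_nil, List.prod_cons, List.prod_nil, mul_one, hinv]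
    rw [adjSwap_apply (by omega) (by omega), ih]
    split_ifs <;> omega

/-- Counting from 0, row `i` of the diagram belongs to the left-block element `c₁ - 1 - i` and
column `k` to the right-block element `c₁ + k`. Row 0 jumps first; later rows are no longer, so they
never reach elements that have already jumped. -/
theorem partial_jumpProd_inv_apply {c₁ c₂ : ℕ} (hn : c₁ + c₂ = n) (μ : YoungDiagram)
    (hμ : μ.rowLen 0 < c₂) (l : ℕ) (hl : l ≤ c₁) (q : Fin n) :
    (((((List.range l).map fun j =>
      ((List.range (μ.rowLen j)).map fun m => adjSwap n (c₁ - j + m)).prod).prod)⁻¹ q : Fin n)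
        : ℕ) =
      if (q : ℕ) < c₁ then (if c₁ - 1 - q < l then q + μ.rowLen (c₁ - 1 - q) else q)
      else q - min l (μ.colLen (q - c₁)) := by
  induction l with
  | zero => simp
  | succ l ih =>
    have ih := ih (by omega)
    have h₀ := μ.rowLen_anti 0 l (Nat.zero_le l)
    rw [List.range_succ, List.map_append, List.prod_append, mul_inv_rev, Equiv.Perm.mul_apply]
    simp only [List.map_cons, List.map_nil, List.prod_cons, List.prod_nil, mul_one]
    rw [prod_adjSwap_inv_apply (by omega) _ (by omega), ih]
    have hq := q.isLt
    by_cases h₁ : (q : ℕ) < c₁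
    · simp only [h₁, if_true]
      rcases lt_trichotomy (c₁ - 1 - (q : ℕ)) l with h₂ | h₂ | h₂
      · have := μ.rowLen_anti _ _ h₂.le
        simp only [h₂, h₂.trans (Nat.lt_succ_self l), if_true]
        rw [if_neg (by omega), if_neg (by omega)]
      · rw [h₂]
        simp only [lt_irrefl, if_false, Nat.lt_succ_self, if_true]
        rw [if_pos (by omega)]
      · have h₃ : ¬ c₁ - 1 - (q : ℕ) < l + 1 := by omega
        simp only [h₂.not_gt, h₃, if_false]
        rw [if_neg (by omega), if_neg (by omega)]
    · simp only [h₁, if_false]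
      -- Row `l` jumps over the element of column `k` exactly when the cell `(l, k)` is in the
      -- diagram, read off by rows or by columns.
      have h₃ : (q : ℕ) - c₁ < μ.rowLen l ↔ l < μ.colLen (q - c₁) := by
        rw [← YoungDiagram.mem_iff_lt_rowLen, YoungDiagram.mem_iff_lt_colLen]
      rw [if_neg (by omega)]
      by_cases h₄ : l < μ.colLen (q - c₁)
      · have := h₃.2 h₄
        rw [if_pos (by omega)]
        omega
      · have := mt h₃.1 h₄
        rw [if_neg (by omega)]
        omega

theorem colLen_le_colLen_zero (μ : YoungDiagram) (k : ℕ) : μ.colLen k ≤ μ.colLen 0 :=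
  μ.colLen_anti 0 k (Nat.zero_le k)

theorem jumpProd_inv_apply_of_lt {c₁ c₂ : ℕ} (hn : c₁ + c₂ = n) {μ : YoungDiagram}
    (hμ : μ.rowLen 0 < c₂) (hμ' : μ.colLen 0 ≤ c₁) {q : Fin n} (hq : (q : ℕ) < c₁) :
    ((jumpProd n c₁ μ)⁻¹ q : ℕ) = q + μ.rowLen (c₁ - 1 - q) := by
  have h := partial_jumpProd_inv_apply hn μ hμ _ hμ' q
  rw [if_pos hq] at h
  refine h.trans ?_
  split_ifs with h'
  · rfl
  · have : ¬ 0 < μ.rowLen (c₁ - 1 - q) := by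
      rwa [← YoungDiagram.mem_iff_lt_rowLen, YoungDiagram.mem_iff_lt_colLen]
    omega

theorem jumpProd_inv_apply_of_ge {c₁ c₂ : ℕ} (hn : c₁ + c₂ = n) {μ : YoungDiagram}
    (hμ : μ.rowLen 0 < c₂) (hμ' : μ.colLen 0 ≤ c₁) {q : Fin n} (hq : c₁ ≤ (q : ℕ)) :
    ((jumpProd n c₁ μ)⁻¹ q : ℕ) = q - μ.colLen (q - c₁) := by
  have h := partial_jumpProd_inv_apply hn μ hμ _ hμ' q
  rw [if_neg (not_lt.2 hq), min_eq_right (colLen_le_colLen_zero μ _)] at h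
  exact h

/-- In the left block, elements further right jump at least as far; in the right block, elements
further right are shifted left by at most as much. -/
theorem jumpProd_inv_lt_of_lt {c₁ c₂ : ℕ} (hn : c₁ + c₂ = n) {μ : YoungDiagram}
    (hμ : μ.rowLen 0 < c₂) (hμ' : μ.colLen 0 ≤ c₁) {q q' : Fin n}
    (h : (q : ℕ) < c₁ ↔ (q' : ℕ) < c₁) :
    (jumpProd n c₁ μ)⁻¹ q < (jumpProd n c₁ μ)⁻¹ q' ↔ q < q' := by
  have key : ∀ {q q' : Fin n}, ((q : ℕ) < c₁ ↔ (q' : ℕ) < c₁) → q < q' →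
      (jumpProd n c₁ μ)⁻¹ q < (jumpProd n c₁ μ)⁻¹ q' := by
    intro q q' h hqq
    rw [Fin.lt_def] at hqq ⊢
    by_cases hq : (q : ℕ) < c₁
    · rw [jumpProd_inv_apply_of_lt hn hμ hμ' hq, jumpProd_inv_apply_of_lt hn hμ hμ' (h.1 hq)]
      have := μ.rowLen_anti (c₁ - 1 - q') (c₁ - 1 - q) (by omega)
      omega
    · have hq' := mt h.2 hq
      rw [jumpProd_inv_apply_of_ge hn hμ hμ' (not_lt.1 hq),
        jumpProd_inv_apply_of_ge hn hμ hμ' (not_lt.1 hq')]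
      have := μ.colLen_anti (q - c₁) (q' - c₁) (by omega)
      have := colLen_le_colLen_zero μ (q - c₁)
      omega
  refine ⟨fun h' => ?_, key h⟩
  by_contra hc
  rcases (not_lt.1 hc).eq_or_lt with rfl | hc
  · exact lt_irrefl _ h'
  · exact lt_asymm h' (key h.symm hc)

theorem jumpProd_inv_lt_iff {c₁ c₂ : ℕ} (hn : c₁ + c₂ = n) {μ : YoungDiagram}
    (hμ : μ.rowLen 0 < c₂) (hμ' : μ.colLen 0 ≤ c₁) {q q' : Fin n} (hq : (q : ℕ) < c₁)
    (hq' : c₁ ≤ (q' : ℕ)) :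
    (jumpProd n c₁ μ)⁻¹ q' < (jumpProd n c₁ μ)⁻¹ q ↔ (c₁ - 1 - (q : ℕ), (q' : ℕ) - c₁) ∈ μ := by
  rw [Fin.lt_def, jumpProd_inv_apply_of_lt hn hμ hμ' hq, jumpProd_inv_apply_of_ge hn hμ hμ' hq']
  have h₁ := YoungDiagram.mem_iff_lt_rowLen (μ := μ) (i := c₁ - 1 - q) (j := q' - c₁)
  have h₂ := YoungDiagram.mem_iff_lt_colLen (μ := μ) (i := c₁ - 1 - q) (j := q' - c₁)
  have h₃ := colLen_le_colLen_zero μ (q' - c₁)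
  by_cases h : (c₁ - 1 - (q : ℕ), (q' : ℕ) - c₁) ∈ μ
  · have h₁ := h₁.1 h
    have h₂ := h₂.1 h
    simp only [h, iff_true]
    omega
  · have h₁ := mt h₁.2 h
    have h₂ := mt h₂.2 h
    simp only [h, iff_false]
    omega

/-- With a cell, the diagram contains all cells above it in its first-column shadow and all cells to
its left in its row; these number `i + j + 1`. -/
theorem card_ge_of_mem {μ : YoungDiagram} {i j : ℕ} (h : (i, j) ∈ μ) : i + j + 1 ≤ μ.card := by
  have hsub : (Finset.range (i + 1)).image (fun a => (a, 0)) ∪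
      (Finset.range j).image (fun b => (i, b + 1)) ⊆ μ.cells := by
    intro p hp
    rw [YoungDiagram.mem_cells]
    simp only [Finset.mem_union, Finset.mem_image, Finset.mem_range] at hp
    rcases hp with ⟨a, ha, rfl⟩ | ⟨b, hb, rfl⟩
    · exact μ.up_left_mem (by omega) (Nat.zero_le j) h
    · exact μ.up_left_mem le_rfl (by omega) h
  have := Finset.card_le_card hsub
  rw [Finset.card_union_of_disjoint, Finset.card_image_of_injective,
    Finset.card_image_of_injective, Finset.card_range, Finset.card_range] at this
  · rw [YoungDiagram.card]; omega
  · intro a b hab; simpa using hab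
  · intro a b hab; simpa using hab
  · rw [Finset.disjoint_left]
    intro p hp hp'
    simp only [Finset.mem_image, Finset.mem_range] at hp hp'
    obtain ⟨a, -, rfl⟩ := hp
    obtain ⟨b, -, hb⟩ := hp'
    simp at hb

/-! ### Noninversions of a layered permutation after jumps -/

theorem IsLayered.apply_of_lt {c₁ c₂ : ℕ} {π : Equiv.Perm (Fin n)} (hπ : IsLayered c₁ c₂ π)
    {i : Fin n} (hi : (i : ℕ) < c₁) : (π i : ℕ) = c₁ - 1 - i := by
  have := hπ.2.2.2.1 i hi
  omega

theorem IsLayered.apply_of_ge {c₁ c₂ : ℕ} {π : Equiv.Perm (Fin n)} (hπ : IsLayered c₁ c₂ π)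
    {i : Fin n} (hi : c₁ ≤ (i : ℕ)) : (π i : ℕ) = n - 1 - (i - c₁) := by
  have := hπ.2.2.2.2 i hi
  omega

theorem IsLayered.apply_lt_iff {c₁ c₂ : ℕ} {π : Equiv.Perm (Fin n)} (hπ : IsLayered c₁ c₂ π)
    {i : Fin n} : (π i : ℕ) < c₁ ↔ (i : ℕ) < c₁ := by
  obtain ⟨h₁, h₂, h₃, -⟩ := id hπ
  have hi := i.isLt
  constructor
  · intro h
    by_contra hc
    rw [hπ.apply_of_ge (not_lt.1 hc)] at h
    omega
  · intro h
    rw [hπ.apply_of_lt h]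
    omega

theorem IsLayered.apply_lt_apply {c₁ c₂ : ℕ} {π : Equiv.Perm (Fin n)} (hπ : IsLayered c₁ c₂ π)
    {i j : Fin n} (h : (i : ℕ) < c₁ ↔ (j : ℕ) < c₁) (hij : i < j) : π j < π i := by
  have hj := j.isLt
  rw [Fin.lt_def] at hij ⊢
  by_cases hi : (i : ℕ) < c₁
  · rw [hπ.apply_of_lt hi, hπ.apply_of_lt (h.1 hi)]
    omega
  · rw [hπ.apply_of_ge (not_lt.1 hi), hπ.apply_of_ge (not_lt.1 (mt h.2 hi))]
    omega

variable {c₁ c₂ : ℕ} {π : Equiv.Perm (Fin n)}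

theorem JumpPartition.apply_jumpProd_inv (J : JumpPartition c₁ c₂) (q : Fin n) :
    J.apply π ((jumpProd n c₁ J.inner)⁻¹ q) = (jumpProd n c₁ J.outer)⁻¹ (π q) := by
  simp [JumpPartition.apply, Equiv.Perm.mul_apply]

/-- The two blocks of a layered permutation remain decreasing after the jumps. -/
theorem JumpPartition.apply_lt_apply (J : JumpPartition c₁ c₂) (hπ : IsLayered c₁ c₂ π)
    {q q' : Fin n} (h : (q : ℕ) < c₁ ↔ (q' : ℕ) < c₁)
    (hlt : (jumpProd n c₁ J.inner)⁻¹ q < (jumpProd n c₁ J.inner)⁻¹ q') :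
    J.apply π ((jumpProd n c₁ J.inner)⁻¹ q') < J.apply π ((jumpProd n c₁ J.inner)⁻¹ q) := by
  have hn := hπ.2.2.1
  rw [jumpProd_inv_lt_of_lt hn J.inner_first J.inner_length h] at hlt
  rw [J.apply_jumpProd_inv, J.apply_jumpProd_inv,
    jumpProd_inv_lt_of_lt hn J.outer_first J.outer_length
      (by rw [hπ.apply_lt_iff, hπ.apply_lt_iff, h])]
  exact hπ.apply_lt_apply h hlt

/-- A cell and its image under rotation of the rectangle force at least `(i + k + 1) + (c₁ + c₂ - 1
- i - k) = c₁ + c₂` cells in total. -/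
theorem not_mem_or_not_mem_of_card_lt {μ ν : YoungDiagram} (h : μ.card + ν.card < c₁ + c₂)
    {i k : ℕ} (hi : i < c₁) (hk : k < c₂) : (i, k) ∉ μ ∨ (c₁ - 1 - i, c₂ - 1 - k) ∉ ν := by
  by_contra! hc
  have h₁ := card_ge_of_mem hc.1
  have h₂ := card_ge_of_mem hc.2
  omega

/-- After the jumps, two entries form a noninversion if and only if the first is from the left
block, the second from the right block, and neither diagram has the cell of this pair. -/
theorem JumpPartition.noninversion_iff (J : JumpPartition c₁ c₂) (hπ : IsLayered c₁ c₂ π)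
    (hJ : J.size < c₁ + c₂) (q q' : Fin n) :
    (jumpProd n c₁ J.inner)⁻¹ q < (jumpProd n c₁ J.inner)⁻¹ q' ∧
        J.apply π ((jumpProd n c₁ J.inner)⁻¹ q) < J.apply π ((jumpProd n c₁ J.inner)⁻¹ q') ↔
      (q : ℕ) < c₁ ∧ c₁ ≤ (q' : ℕ) ∧ (c₁ - 1 - (q : ℕ), (q' : ℕ) - c₁) ∉ J.inner ∧
        ((q : ℕ), c₂ - 1 - ((q' : ℕ) - c₁)) ∉ J.outer := by
  have hn := hπ.2.2.1
  by_cases h : (q : ℕ) < c₁ ↔ (q' : ℕ) < c₁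
  · constructor
    · exact fun h' => absurd h'.2 (J.apply_lt_apply hπ h h'.1).not_gt
    · rintro ⟨h₁, h₂, -⟩
      omega
  have cross : ∀ {q q' : Fin n}, (q : ℕ) < c₁ → c₁ ≤ (q' : ℕ) →
      ((jumpProd n c₁ J.inner)⁻¹ q' < (jumpProd n c₁ J.inner)⁻¹ q ↔
        (c₁ - 1 - (q : ℕ), (q' : ℕ) - c₁) ∈ J.inner) ∧
      (J.apply π ((jumpProd n c₁ J.inner)⁻¹ q') < J.apply π ((jumpProd n c₁ J.inner)⁻¹ q) ↔
        ((q : ℕ), c₂ - 1 - ((q' : ℕ) - c₁)) ∈ J.outer) := by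
    intro q q' hq hq'
    refine ⟨jumpProd_inv_lt_iff hn J.inner_first J.inner_length hq hq', ?_⟩
    rw [J.apply_jumpProd_inv, J.apply_jumpProd_inv,
      jumpProd_inv_lt_iff hn J.outer_first J.outer_length (hπ.apply_lt_iff.2 hq)
        (not_lt.1 (mt hπ.apply_lt_iff.1 (not_lt.2 hq'))), hπ.apply_of_lt hq, hπ.apply_of_ge hq']
    have := q'.isLt
    -- Since `π` reverses each block, the outer cell of a pair is the inner one rotated by 180° in
    -- the rectangle.
    rw [show c₁ - 1 - (c₁ - 1 - (q : ℕ)) = q by omega,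
      show n - 1 - ((q' : ℕ) - c₁) - c₁ = c₂ - 1 - ((q' : ℕ) - c₁) by omega]
  by_cases hq : (q : ℕ) < c₁
  · have hq' : c₁ ≤ (q' : ℕ) := not_lt.1 fun h' => h ⟨fun _ => h', fun _ => hq⟩
    have hne : q ≠ q' := by
      rintro rfl
      omega
    obtain ⟨e₁, e₂⟩ := cross hq hq'
    have hne₁ := ((jumpProd n c₁ J.inner)⁻¹).injective.ne hne
    have hne₂ := (J.apply π).injective.ne hne₁
    rw [← e₁, ← e₂, not_lt, not_lt, hne₁.le_iff_lt, hne₂.le_iff_lt]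
    simp only [hq, hq', true_and]
  · have hq' : (q' : ℕ) < c₁ := by
      by_contra hq'
      exact h ⟨fun h' => absurd h' hq, fun h' => absurd h' hq'⟩
    obtain ⟨e₁, e₂⟩ := cross hq' (not_lt.1 hq)
    rw [e₁, e₂]
    have hlt := q.isLt
    -- A cross pair exchanged both in position and in value would become a noninversion again, in
    -- the opposite order; the size bound rules this out.
    have h₁ := not_mem_or_not_mem_of_card_lt hJ (i := c₁ - 1 - q') (k := q - c₁) (by omega)
      (by omega)
    rw [show c₁ - 1 - (c₁ - 1 - (q' : ℕ)) = q' by omega] at h₁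
    constructor
    · rintro ⟨h₂, h₃⟩
      tauto
    · rintro ⟨h₂, -⟩
      exact absurd h₂ hq

theorem JumpPartition.nonInv_apply (J : JumpPartition c₁ c₂) (hπ : IsLayered c₁ c₂ π)
    (hJ : J.size < c₁ + c₂) : nonInv (J.apply π) + J.size = c₁ * c₂ := by
  have hn := hπ.2.2.1
  set M := (jumpProd n c₁ J.inner)⁻¹ with hM
  let rot : ℕ × ℕ → ℕ × ℕ := fun p => (c₁ - 1 - p.1, c₂ - 1 - p.2)
  have hin : J.inner.cells ⊆ Finset.range c₁ ×ˢ Finset.range c₂ := by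
    rintro ⟨i, k⟩ h
    rw [YoungDiagram.mem_cells] at h
    have h₁ := YoungDiagram.mem_iff_lt_rowLen.1 h
    have h₂ := YoungDiagram.mem_iff_lt_colLen.1 h
    have := J.inner.rowLen_anti 0 i (Nat.zero_le i)
    have := colLen_le_colLen_zero J.inner k
    have := J.inner_first
    have := J.inner_length
    simp only [Finset.mem_product, Finset.mem_range]
    omega
  have hout : J.outer.cells ⊆ Finset.range c₁ ×ˢ Finset.range c₂ := by
    rintro ⟨i, k⟩ h
    rw [YoungDiagram.mem_cells] at h
    have h₁ := YoungDiagram.mem_iff_lt_rowLen.1 h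
    have h₂ := YoungDiagram.mem_iff_lt_colLen.1 h
    have := J.outer.rowLen_anti 0 i (Nat.zero_le i)
    have := colLen_le_colLen_zero J.outer k
    have := J.outer_first
    have := J.outer_length
    simp only [Finset.mem_product, Finset.mem_range]
    omega
  have hrot : ∀ p ∈ Finset.range c₁ ×ˢ Finset.range c₂,
      rot p ∈ Finset.range c₁ ×ˢ Finset.range c₂ ∧ rot (rot p) = p := by
    rintro ⟨i, k⟩ h
    simp only [rot, Finset.mem_product, Finset.mem_range, Prod.mk.injEq] at h ⊢
    omega
  have hcard : (J.outer.cells.image rot).card = J.outer.card :=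
    Finset.card_image_of_injOn fun p hp p' hp' h => by
      rw [← (hrot p (hout hp)).2, ← (hrot p' (hout hp')).2, h]
  have hdisj : Disjoint J.inner.cells (J.outer.cells.image rot) := by
    rw [Finset.disjoint_left]
    rintro p hp hp'
    obtain ⟨p', hmem', rfl⟩ := Finset.mem_image.1 hp'
    obtain ⟨hmem, hrr⟩ := hrot p' (hout hmem')
    simp only [Finset.mem_product, Finset.mem_range] at hmem
    rcases not_mem_or_not_mem_of_card_lt hJ hmem.1 hmem.2 with h | h
    · exact h hp
    · refine h ?_
      change rot (rot p') ∈ J.outer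
      rw [hrr]
      exact hmem'
  have hsub : J.inner.cells ∪ J.outer.cells.image rot ⊆ Finset.range c₁ ×ˢ Finset.range c₂ := by
    refine Finset.union_subset hin fun p hp => ?_
    obtain ⟨p', hp', rfl⟩ := Finset.mem_image.1 hp
    exact (hrot p' (hout hp')).1
  have hE : nonInv (J.apply π) = ((Finset.range c₁ ×ˢ Finset.range c₂) \
      (J.inner.cells ∪ J.outer.cells.image rot)).card := by
    have hmem : ∀ p : ℕ × ℕ, p ∈ Finset.range c₁ ×ˢ Finset.range c₂ →
        (p ∈ J.outer.cells.image rot ↔ rot p ∈ J.outer) := by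
      intro p hp
      rw [Finset.mem_image]
      constructor
      · rintro ⟨p', hp', rfl⟩
        rw [(hrot p' (hout hp')).2]
        exact hp'
      · exact fun h => ⟨rot p, h, (hrot p hp).2⟩
    -- A noninversion is sent to its inner cell; `M⁻¹` returns its positions to those before the
    -- jumps.
    refine Finset.card_bij (fun p _ => (c₁ - 1 - (M⁻¹ p.1 : ℕ), (M⁻¹ p.2 : ℕ) - c₁)) ?_ ?_ ?_
    · rintro ⟨a, b⟩ h
      simp only [Finset.mem_filter, Finset.mem_univ, true_and] at h
      have h' := (J.noninversion_iff hπ hJ (M⁻¹ a) (M⁻¹ b)).1 (by simpa [hM] using h)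
      have hb := (M⁻¹ b).isLt
      have hr : (c₁ - 1 - (M⁻¹ a : ℕ), (M⁻¹ b : ℕ) - c₁) ∈
          Finset.range c₁ ×ˢ Finset.range c₂ := by
        simp only [Finset.mem_product, Finset.mem_range]
        omega
      rw [Finset.mem_sdiff, Finset.mem_union, hmem _ hr]
      refine ⟨hr, ?_⟩
      rintro (h₁ | h₁)
      · exact h'.2.2.1 h₁
      · refine h'.2.2.2 ?_
        have : c₁ - 1 - (c₁ - 1 - (M⁻¹ a : ℕ)) = M⁻¹ a := by omega
        simpa only [rot, this] using h₁
    · rintro ⟨a, b⟩ h ⟨c, d⟩ h' heq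
      simp only [Finset.mem_filter, Finset.mem_univ, true_and] at h h'
      have h := (J.noninversion_iff hπ hJ (M⁻¹ a) (M⁻¹ b)).1 (by simpa [hM] using h)
      have h' := (J.noninversion_iff hπ hJ (M⁻¹ c) (M⁻¹ d)).1 (by simpa [hM] using h')
      simp only [Prod.mk.injEq] at heq ⊢
      rw [← (M⁻¹).injective.eq_iff, ← (M⁻¹).injective.eq_iff (a := b), Fin.ext_iff, Fin.ext_iff]
      omega
    · rintro ⟨i, k⟩ h
      rw [Finset.mem_sdiff, Finset.mem_union] at h
      obtain ⟨hr, h⟩ := h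
      rw [hmem _ hr, not_or] at h
      simp only [Finset.mem_product, Finset.mem_range] at hr
      have hk : c₁ - 1 - (c₁ - 1 - i) = i := by omega
      refine ⟨(M ⟨c₁ - 1 - i, by omega⟩, M ⟨c₁ + k, by omega⟩), ?_, ?_⟩
      · simp only [Finset.mem_filter, Finset.mem_univ, true_and]
        refine (J.noninversion_iff hπ hJ _ _).2 ⟨by simp only; omega, by simp, ?_, ?_⟩
        · simpa [hk] using h.1
        · simpa [rot] using h.2
      · have e : ∀ x, M⁻¹ (M x) = x := M.symm_apply_apply
        simp only [e, hk, Nat.add_sub_cancel_left]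
  rw [hE, Finset.card_sdiff_of_subset hsub, Finset.card_union_of_disjoint hdisj, hcard,
    Finset.card_product, Finset.card_range, Finset.card_range, JumpPartition.size]
  have := Finset.card_le_card hsub
  rw [Finset.card_union_of_disjoint hdisj, hcard, Finset.card_product, Finset.card_range,
    Finset.card_range] at this
  exact Nat.sub_add_cancel this

end JumpPerm

/-! ### Minimal permutations and the shape after jumps -/

namespace JumpPerm

theorem exists_isLayered {c₁ c₂ n : ℕ} (h₁ : 0 < c₁) (h₂ : 0 < c₂) (hn : c₁ + c₂ = n) :
    ∃ π : Equiv.Perm (Fin n), IsLayered c₁ c₂ π := by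
  let f : Fin n → Fin n := fun i =>
    ⟨if (i : ℕ) < c₁ then c₁ - 1 - i else n - 1 - (i - c₁), by split_ifs <;> omega⟩
  have hf : Function.Injective f := by
    intro i j h
    have hi := i.isLt
    have hj := j.isLt
    simp only [f, Fin.mk.injEq] at h
    rw [Fin.ext_iff]
    split_ifs at h <;> omega
  refine ⟨Equiv.ofBijective f (Finite.injective_iff_bijective.1 hf), h₁, h₂, hn, ?_, ?_⟩
  · intro i hi
    simp only [Equiv.ofBijective_apply, f, hi, if_true]
    omega
  · intro i hi
    simp only [Equiv.ofBijective_apply, f, not_lt.2 hi, if_false]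
    omega

/-- The first entry determines `c₁`. -/
theorem IsLayered.unique {n c₁ c₂ d₁ d₂ : ℕ} {π : Equiv.Perm (Fin n)} (h : IsLayered c₁ c₂ π)
    (h' : IsLayered d₁ d₂ π) : c₁ = d₁ ∧ c₂ = d₂ := by
  obtain ⟨h₁, h₂, h₃, h₄, -⟩ := h
  obtain ⟨h₁', h₂', h₃', h₄', -⟩ := h'
  have e := h₄ ⟨0, by omega⟩ h₁
  have e' := h₄' ⟨0, by omega⟩ h₁'
  simp only at e e'
  omega

variable {s r : ℕ} {lam : YoungDiagram} {π : Equiv.Perm (Fin (s + r))}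

theorem nonInv_le_of_hasShape (hr : 0 < r) (hrs : r ≤ s) (hlam : lam.transpose.rowLens = [s, r])
    (hπ : HasShape π lam) :
    nonInv π ≤ r * s ∧ (nonInv π = r * s → IsLayered s r π ∨ IsLayered r s π) := by
  obtain ⟨h₁, ⟨A, hA, hdec⟩, h₃⟩ := (hasShape_iff hrs hlam π).1 hπ
  have hA' : Aᶜ.card = r := by
    rw [Finset.card_compl, hA, Fintype.card_fin, Nat.add_sub_cancel_left]
  have := nonInv_le h₁ hA hdec h₃
  rw [hA'] at this
  exact ⟨this.1, fun h =>
    isLayered_of_nonInvNeighbors (hr.trans_le hrs) hr h₁ hA hA' hdec (this.2 h)⟩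

theorem JumpPartition.hasShape_apply {c₁ c₂ : ℕ} (J : JumpPartition c₁ c₂) (hrs : r ≤ s)
    (hlam : lam.transpose.rowLens = [s, r]) (hc : c₁ = s ∧ c₂ = r ∨ c₁ = r ∧ c₂ = s)
    (hπ : IsLayered c₁ c₂ π) (hJ : J.size < r) : HasShape (J.apply π) lam := by
  have hn := hπ.2.2.1
  -- These are the positions that the left block occupies after the inner jumps.
  set A : Finset (Fin (s + r)) :=
    Finset.univ.filter fun p => (jumpProd (s + r) c₁ J.inner p : ℕ) < c₁ with hA
  have hcard : A.card = c₁ := by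
    have : A.map (jumpProd (s + r) c₁ J.inner).toEmbedding =
        Finset.univ.filter fun q : Fin (s + r) => (q : ℕ) < c₁ := by
      ext q
      simp [hA, Finset.mem_map_equiv]
    rw [← Finset.card_map (jumpProd (s + r) c₁ J.inner).toEmbedding, this,
      Fin.card_filter_val_lt]
    omega
  have hcard' : Aᶜ.card = c₂ := by
    rw [Finset.card_compl, hcard, Fintype.card_fin]
    omega
  have hblock : ∀ i j : Fin (s + r), (i ∈ A ↔ j ∈ A) → i < j → J.apply π j < J.apply π i := by
    intro i j h hij
    have := J.apply_lt_apply hπ (q := jumpProd (s + r) c₁ J.inner i)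
      (q' := jumpProd (s + r) c₁ J.inner j) (by simpa [hA] using h) (by simpa using hij)
    simpa using this
  have hdec : Decreasing (J.apply π) A := fun i hi j hj => hblock i j (iff_of_true hi hj)
  have hdec' : Decreasing (J.apply π) Aᶜ := fun i hi j hj =>
    hblock i j (iff_of_false (Finset.mem_compl.1 hi) (Finset.mem_compl.1 hj))
  have hcount := J.nonInv_apply hπ (by omega)
  refine (hasShape_iff hrs hlam _).2
    ⟨not_hasIncreasingTriple_of_decreasing hdec hdec', ?_, fun B hB => ?_⟩
  · rcases hc with hc | hc
    · exact ⟨A, hcard.trans hc.1, hdec⟩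
    · exact ⟨Aᶜ, hcard'.trans hc.2, hdec'⟩
  · refine card_le_of_decreasing hdec hdec' (by omega) (by omega) hrs ?_ hB
    rw [hcard, hcard', ← hcount]
    omega

/-- The pair of empty partitions. -/
def JumpPartition.empty {c₁ c₂ : ℕ} (h₂ : 0 < c₂) : JumpPartition c₁ c₂ where
  inner := ⊥
  outer := ⊥
  inner_length := by simp [YoungDiagram.colLen_eq_card, YoungDiagram.col]
  inner_first := by simpa [YoungDiagram.rowLen_eq_card, YoungDiagram.row] using h₂
  outer_length := by simp [YoungDiagram.colLen_eq_card, YoungDiagram.col]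
  outer_first := by simpa [YoungDiagram.rowLen_eq_card, YoungDiagram.row] using h₂

theorem JumpPartition.empty_size {c₁ c₂ : ℕ} (h₂ : 0 < c₂) :
    (JumpPartition.empty h₂ : JumpPartition c₁ c₂).size = 0 := by
  simp [JumpPartition.size, JumpPartition.empty]

theorem JumpPartition.empty_apply {c₁ c₂ : ℕ} (h₂ : 0 < c₂) :
    (JumpPartition.empty h₂ : JumpPartition c₁ c₂).apply π = π := by
  have : (⊥ : YoungDiagram).colLen 0 = 0 := by
    simp [YoungDiagram.colLen_eq_card, YoungDiagram.col]
  simp [JumpPartition.apply, JumpPartition.empty, jumpProd, this]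

/-- This is the case of the pair of empty partitions, whose size `0` is below `r`. -/
theorem IsLayered.hasShape {c₁ c₂ : ℕ} (hr : 0 < r) (hrs : r ≤ s)
    (hlam : lam.transpose.rowLens = [s, r]) (hc : c₁ = s ∧ c₂ = r ∨ c₁ = r ∧ c₂ = s)
    (hπ : IsLayered c₁ c₂ π) : HasShape π lam ∧ nonInv π = r * s := by
  have h₁ := (JumpPartition.empty (c₁ := c₁) hπ.2.1).hasShape_apply hrs hlam hc hπ
    (by rwa [JumpPartition.empty_size])
  have h₂ := (JumpPartition.empty (c₁ := c₁) hπ.2.1).nonInv_apply hπ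
    (by rw [JumpPartition.empty_size]; omega)
  rw [JumpPartition.empty_apply] at h₁ h₂
  rw [JumpPartition.empty_size, add_zero] at h₂
  refine ⟨h₁, h₂.trans ?_⟩
  rcases hc with ⟨rfl, rfl⟩ | ⟨rfl, rfl⟩
  · exact mul_comm _ _
  · rfl

/-- Inversions and noninversions have a constant sum, so minimal means attaining the bound `r * s`
on noninversions, which the layered permutations do. -/
theorem isMinimal_iff (hr : 0 < r) (hrs : r ≤ s) (hlam : lam.transpose.rowLens = [s, r]) :
    IsMinimal lam π ↔ IsLayered s r π ∨ IsLayered r s π := by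
  constructor
  · rintro ⟨h₁, h₂⟩
    obtain ⟨π₀, h₀⟩ := exists_isLayered (hr.trans_le hrs) hr rfl
    obtain ⟨h₃, h₄⟩ := h₀.hasShape hr hrs hlam (Or.inl ⟨rfl, rfl⟩)
    obtain ⟨h₅, h₆⟩ := nonInv_le_of_hasShape hr hrs hlam h₁
    have := h₂ π₀ h₃
    have := inv_add_nonInv π
    have := inv_add_nonInv π₀
    exact h₆ (by omega)
  · intro h
    have : HasShape π lam ∧ nonInv π = r * s := by
      rcases h with h | h
      · exact h.hasShape hr hrs hlam (Or.inl ⟨rfl, rfl⟩)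
      · exact h.hasShape hr hrs hlam (Or.inr ⟨rfl, rfl⟩)
    refine ⟨this.1, fun σ hσ => ?_⟩
    have h₁ := (nonInv_le_of_hasShape hr hrs hlam hσ).1
    have := inv_add_nonInv π
    have := inv_add_nonInv σ
    omega

end JumpPerm

theorem mainTheorem4 (s r Δ : ℕ) (hrs : r ≤ s) (hΔ : Δ < r)
    (lam : YoungDiagram) (hlam : lam.transpose.rowLens = [s, r]) :
    (∀ π : Equiv.Perm (Fin (s + r)),
      JumpPerm.IsMinimal lam π ↔ JumpPerm.IsLayered s r π ∨ JumpPerm.IsLayered r s π) ∧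
    (∀ π : Equiv.Perm (Fin (s + r)), JumpPerm.IsMinimal lam π →
      ∀ c₁ c₂ : ℕ, JumpPerm.IsLayered c₁ c₂ π →
        ∀ J : JumpPerm.JumpPartition c₁ c₂, J.size = Δ →
          J.apply π ∈ JumpPerm.W (s + r) lam Δ) := by
  have hr : 0 < r := (Nat.zero_le Δ).trans_lt hΔ
  refine ⟨fun π => JumpPerm.isMinimal_iff hr hrs hlam, fun π hmin c₁ c₂ hπ J hJ => ?_⟩
  -- The composition of a layered permutation is unique, so the given `c₁, c₂` are `s, r` in one of
  -- the two orders.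
  have hc : c₁ = s ∧ c₂ = r ∨ c₁ = r ∧ c₂ = s :=
    ((JumpPerm.isMinimal_iff hr hrs hlam).1 hmin).imp hπ.unique hπ.unique
  refine ⟨J.hasShape_apply hrs hlam hc hπ (by omega), π, hmin, ?_⟩
  have h₁ := J.nonInv_apply hπ (by omega)
  have h₂ := (hπ.hasShape hr hrs hlam hc).2
  have h₃ : c₁ * c₂ = r * s := by
    rcases hc with ⟨rfl, rfl⟩ | ⟨rfl, rfl⟩
    · exact mul_comm _ _
    · rfl
  have := JumpPerm.inv_add_nonInv π
  have := JumpPerm.inv_add_nonInv (J.apply π)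
  omega
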